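/- Let $\Omega\subset\mathbb R^2$ be a bounded polygonal domain with Lipschitz boundary, let $\alpha\in[0,1]$, let $u(x_1,x_2)=x_1^2+x_2^2$, and let $C(u)\in\mathbb R$. For a conforming triangulation $\mathcal T_h$ of $\Omega$ all of whose elements have diameter at most $h>0$, let $X_h$ be the space of continuous functions on $\overline\Omega$ that are affine on each element. A straight band of length $L$ in $\mathcal T_h$ is a union $\mathcal B=\bigcup_{i=0}^N K_i\cup\bigcup_{i=1}^N\tilde K_i$, $N\ge 1$, of elements $K_i=P_iA_iP_{i+1}$ $(0\le i\le N)$ and $\tilde K_i=A_{i-1}P_iA_i$ $(1\le i\le N)$ of $\mathcal T_h$, where $P_0,P_1,\dots,P_{N+1}$ are distinct points lying in this order on a line, $L=|P_0P_{N+1}|$, the maximum angle $\alpha_i$ of $K_i$ is attained at the vertex $A_i$ (so the longest edge of $K_i$ is $P_iP_{i+1}$), and the maximum angle $\tilde\alpha_i$ of $\tilde K_i$ is attained at the vertex $P_i$. The area of a triangle $K$ is denoted by $|K|$, and $|v|_{H^1(S)}=\bigl(\int_S|\nabla v|^2\,dx\bigr)^{1/2}$. Then there are constants $C_L,C_1>0$,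 depending only on $\Omega$, $\alpha$ and $C(u)$, and for all $C_K,C_\alpha\in\mathbb R$ a constant $C_2>0$, depending only on $\Omega,\alpha,C(u),C_K,C_\alpha$, such that the following holds for every $h>0$, every such triangulation $\mathcal T_h$, every $U\in X_h$ and every straight band $\mathcal B$ in $\mathcal T_h$. If $$|u-U|_{H^1(\Omega)}\le C(u)h^\alpha,$$ $$|\tilde K_i|\le C_K|K_i|,\qquad |\tilde K_i|\le C_K|K_{i-1}|,\qquad \sin(\pi-\alpha_{i-1})\le C_\alpha\sin(\pi-\tilde\alpha_i)\qquad(i=1,\dots,N),$$ and $L\ge C_Lh^{2\alpha/5}$, then $$|u-U|_{H^1(\mathcal B)}\ge \mathcal A_1-\mathcal A_2$$ for some real numbers $\mathcal A_1,\mathcal A_2$ with $$\mathcal A_1\ge C_1\min_{1\le i\le N}\frac1{\sin(\pi-\tilde\alpha_i)}\ \min_{1\le i\le N}|\tilde K_i|^{1/2}\ L\,N^{-1/2},\qquad |\mathcal A_2|\le C_2h^\alpha .$$ -/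

import Mathlib

open MeasureTheory

noncomputable section

namespace FEMBand

/-- The Euclidean plane. -/
abbrev Plane : Type := EuclideanSpace ℝ (Fin 2)

/-- The boundary of `Ω` is Lipschitz: near each boundary point, in a suitable orthonormal
coordinate system, `Ω` is the region strictly above the graph of a Lipschitz function. -/
def HasLipschitzBoundary (Ω : Set Plane) : Prop :=
  ∀ x ∈ frontier Ω, ∃ (R : Plane ≃ₗᵢ[ℝ] Plane) (φ : ℝ → ℝ) (M : NNReal) (r : ℝ),
    LipschitzWith M φ ∧ 0 < r ∧ ∀ y ∈ Metric.ball x r, (y ∈ Ω ↔ φ (R y 0) < R y 1)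

/-- Bounded polygonal domains with Lipschitz boundary. -/
structure IsPolygonalLipschitzDomain (Ω : Set Plane) : Prop where
  isOpen : IsOpen Ω
  isConnected : IsConnected Ω
  isBounded : Bornology.IsBounded Ω
  polygonal : ∃ S : Set (Plane × Plane), S.Finite ∧ frontier Ω ⊆ ⋃ p ∈ S, segment ℝ p.1 p.2
  lipschitz : HasLipschitzBoundary Ω

/-- `T` is a conforming triangulation of `Ω`: a finite geometric simplicial complex (its simplices
meet only along common faces) which covers exactly the closure of `Ω`. -/
def IsTriangulation (T : Geometry.SimplicialComplex ℝ Plane) (Ω : Set Plane) : Prop :=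
  T.faces.Finite ∧ T.space = closure Ω

/-- The elements (nondegenerate triangles) of `T`, given by their vertex sets. -/
def elements (T : Geometry.SimplicialComplex ℝ Plane) : Set (Finset Plane) :=
  {K | K ∈ T.faces ∧ K.card = 3}

/-- The space of globally continuous, piecewise linear functions on `T`. -/
def piecewiseLinear (T : Geometry.SimplicialComplex ℝ Plane) : Set (Plane → ℝ) :=
  {U | ContinuousOn U T.space ∧
    ∀ K ∈ elements T, ∃ f : Plane →ᵃ[ℝ] ℝ, Set.EqOn U f (convexHull ℝ (K : Set Plane))}

/-- The seminorm `|v|_{H^1(S)}`, for functions `v` that are continuous and piecewise smooth on a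
triangulation: their weak gradient is the classical one, which exists off the edges, that is,
almost everywhere. -/
def h1Seminorm (S : Set Plane) (v : Plane → ℝ) : ℝ :=
  Real.sqrt (∫ x in S, ‖gradient v x‖ ^ 2)

/-- The quadratic function `x₁² + x₂²`. -/
def quadratic (x : Plane) : ℝ := x 0 ^ 2 + x 1 ^ 2

/-- The closed triangle with vertices `a`, `b`, `c`. -/
def triangle (a b c : Plane) : Set Plane := convexHull ℝ {a, b, c}

/-- The area of the triangle with vertices `a`, `b`, `c`. -/
def area (a b c : Plane) : ℝ := (volume (triangle a b c)).toReal

/-- The maximum angle of the triangle with vertices `a`, `b`, `c`. -/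
def maxAngle (a b c : Plane) : ℝ :=
  max (EuclideanGeometry.angle b a c)
    (max (EuclideanGeometry.angle a b c) (EuclideanGeometry.angle a c b))

/-- `a`, `b`, `c` are the vertices of an element of `T`. -/
def IsElement (T : Geometry.SimplicialComplex ℝ Plane) (a b c : Plane) : Prop :=
  ∃ K ∈ elements T, (K : Set Plane) = {a, b, c}

/-- A straight band in `T`, consisting of the elements `K_i` with vertices `P_i, A_i, P_{i+1}`
(`0 ≤ i ≤ N`) and `K̃_i` with vertices `A_{i-1}, P_i, A_i` (`1 ≤ i ≤ N`). The points `P_i` follow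
each other on a line. The largest angle of `K_i` is at `A_i`, so that `P_i P_{i+1}` is
its longest edge, and the largest angle of `K̃_i` is at `P_i`. Only the values `pos i` with
`i ≤ N + 1` and `apex i` with `i ≤ N` matter. -/
structure StraightBand (T : Geometry.SimplicialComplex ℝ Plane) where
  N : ℕ
  one_le_N : 1 ≤ N
  /-- an endpoint of the straight edge `Γ` -/
  start : Plane
  /-- the direction of `Γ` -/
  dir : Plane
  norm_dir : ‖dir‖ = 1
  /-- the arc length parameter of `P_i` on `Γ` -/
  pos : ℕ → ℝ
  pos_zero : pos 0 = 0
  pos_lt : ∀ i ≤ N, pos i < pos (i + 1)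
  /-- the vertices `A_i` -/
  apex : ℕ → Plane
  elem : ∀ i ≤ N,
    IsElement T (start + pos i • dir) (apex i) (start + pos (i + 1) • dir)
  elem_tilde : ∀ i, 1 ≤ i → i ≤ N →
    IsElement T (apex (i - 1)) (start + pos i • dir) (apex i)
  maxAngle_elem : ∀ i ≤ N,
    maxAngle (start + pos i • dir) (apex i) (start + pos (i + 1) • dir) =
      EuclideanGeometry.angle (start + pos i • dir) (apex i) (start + pos (i + 1) • dir)
  maxAngle_elem_tilde : ∀ i, 1 ≤ i → i ≤ N →
    maxAngle (apex (i - 1)) (start + pos i • dir) (apex i) =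
      EuclideanGeometry.angle (apex (i - 1)) (start + pos i • dir) (apex i)

namespace StraightBand

variable {T : Geometry.SimplicialComplex ℝ Plane} (B : StraightBand T)

/-- The vertex `P_i` on `Γ`. -/
def base (i : ℕ) : Plane := B.start + B.pos i • B.dir

/-- The length `L` of `Γ`. -/
def length : ℝ := B.pos (B.N + 1)

/-- The element `K_i`, `0 ≤ i ≤ N`. -/
def K (i : ℕ) : Set Plane := triangle (B.base i) (B.apex i) (B.base (i + 1))

/-- The element `K̃_i`, `1 ≤ i ≤ N`. -/
def Kt (i : ℕ) : Set Plane := triangle (B.apex (i - 1)) (B.base i) (B.apex i)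

/-- The area `|K_i|`. -/
def areaK (i : ℕ) : ℝ := area (B.base i) (B.apex i) (B.base (i + 1))

/-- The area `|K̃_i|`. -/
def areaKt (i : ℕ) : ℝ := area (B.apex (i - 1)) (B.base i) (B.apex i)

/-- The maximum angle of `K_i`. -/
def angleK (i : ℕ) : ℝ := maxAngle (B.base i) (B.apex i) (B.base (i + 1))

/-- The maximum angle of `K̃_i`. -/
def angleKt (i : ℕ) : ℝ := maxAngle (B.apex (i - 1)) (B.base i) (B.apex i)

/-- The region covered by the band. -/
def region : Set Plane :=
  (⋃ i ∈ Set.Icc 0 B.N, B.K i) ∪ ⋃ i ∈ Set.Icc 1 B.N, B.Kt i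

/-- The minimum of `f i` over `i = 1, …, N`. -/
def minOver (f : ℕ → ℝ) : ℝ :=
  (Finset.Icc 1 B.N).inf' (Finset.nonempty_Icc.mpr B.one_le_N) f

end StraightBand

end FEMBand

end

noncomputable section

namespace FEMBand

/-! The error on the band enters only through its nonnegativity. The assumed global error bound
already forces the explicit lower bound required of `A₁` to be at most a multiple of `h ^ α`. So
`A₁` is taken to be that expression, `A₂` a large enough multiple of `h ^ α`, and `A₁ - A₂ ≤ 0`.

First ingredient (`exists_slope_oscillation`): on a long band the slope of `U` along the line Γ of
the base points varies by more than `δ * L`. Otherwise, with step `a = δ * L`, the second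
differences of `u` along Γ equal `2 * a ^ 2` while those of `U` are at most `a ^ 2`, so those of `u
- U` are at least `a ^ 2`. Integrating over a parallelogram in the closure of Ω with one side on Γ
turns this into a lower bound of order `a ^ 4` for the squared error
(`pow_four_le_integral_gradient_sq`). As `L` is bounded by the diameter of Ω, this contradicts `L ≥
C_L * h ^ (2 * α / 5)`. The parallelogram exists because a Lipschitz domain admits, uniformly in
position, inward directions transversal to any given line (`exists_uniform_direction`).

Second ingredient (`abs_inner_sub_le`): continuity of `U` across the two edges of K̃ at its base
point bounds the jump of slope from one lower triangle to the next by the sines of the large angles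
times differences of the element gradients. A large angle thus makes a jump expensive.

Third ingredient (`sum_volume_mul_norm_sub_sq_le`): the three gradients involved in a jump are
compared with ∇u at their common vertex; weighted by the areas, the squared distances sum to O(`h ^
(2 * α)`). In `minOver_mul_le` the oscillation is bounded by the sum of the jumps, and
Cauchy–Schwarz over the `N` jumps produces the factor `N ^ (-1/2)`. -/

theorem finrank_plane : Module.finrank ℝ Plane = 2 := by simp [Plane]

/-! ### Simplices in the plane and affine functions on them -/

/-- A point or a segment has zero area. -/
theorem volume_convexHull_eq_zero {s : Finset Plane} (hs : s.card ≤ 2) :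
    volume (convexHull ℝ (s : Set Plane)) = 0 := by
  rcases s.eq_empty_or_nonempty with rfl | hne
  · simp
  refine measure_mono_null (convexHull_subset_affineSpan _)
    (Measure.addHaar_affineSubspace _ _ fun htop => ?_)
  have h1 := finrank_vectorSpan_image_finset_le ℝ (id : Plane → Plane) s (n := s.card - 1)
    (by have := hne.card_pos; omega)
  rw [Finset.image_id, ← direction_affineSpan, htop, AffineSubspace.direction_top,
    finrank_top, finrank_plane] at h1
  omega

theorem card_le_three {T : Geometry.SimplicialComplex ℝ Plane} {s : Finset Plane}
    (hs : s ∈ T.faces) : s.card ≤ 3 := by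
  have h1 := (T.indep hs).card_le_finrank_succ
  have h2 := Submodule.finrank_le (vectorSpan ℝ (Set.range ((↑) : s → Plane)))
  rw [finrank_plane] at h2
  simp only [Fintype.card_coe] at h1
  omega

/-- Real affine functions on the plane are given by a gradient and a constant. -/
theorem exists_eq_inner_add (f : Plane →ᵃ[ℝ] ℝ) :
    ∃ (g : Plane) (c : ℝ), ∀ x, f x = inner ℝ g x + c := by
  refine ⟨(InnerProductSpace.toDual ℝ Plane).symm (LinearMap.toContinuousLinearMap f.linear),
    f 0, fun x => ?_⟩
  rw [InnerProductSpace.toDual_symm_apply]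
  have := f.map_vadd 0 x
  simpa using this

/-- The interior of a nondegenerate triangle arises by removing three lines. -/
theorem exists_lines_of_affineIndependent {s : Finset Plane}
    (hs : AffineIndependent ℝ ((↑) : s → Plane)) (hc : s.card = 3) :
    ∃ Z : Set (Plane × ℝ), Z.Finite ∧ (∀ z ∈ Z, z.1 ≠ 0) ∧
      ∀ x ∈ convexHull ℝ (s : Set Plane), (∀ z ∈ Z, inner ℝ z.1 x ≠ z.2) →
        x ∈ interior (convexHull ℝ (s : Set Plane)) := by
  have htop : affineSpan ℝ (Set.range ((↑) : s → Plane)) = ⊤ := by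
    rw [hs.affineSpan_eq_top_iff_card_eq_finrank_add_one, finrank_plane]
    simp [hc]
  let b : AffineBasis s ℝ Plane := ⟨_, hs, htop⟩
  have hb : Set.range b = (s : Set Plane) := Subtype.range_coe
  choose g c hgc using fun i => exists_eq_inner_add (b.coord i)
  -- The lines are the zero sets of the barycentric coordinates. None has zero normal, since a
  -- coordinate is 1 at its own vertex and 0 at another.
  refine ⟨Set.range fun i => (g i, -c i), Set.finite_range _, ?_, fun x hx hZ => ?_⟩
  · rintro _ ⟨i, rfl⟩ h0
    have h0 : g i = 0 := h0
    obtain ⟨j, hj⟩ : ∃ j, j ≠ i := by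
      have : 1 < Fintype.card s := by simp [hc]
      have := Fintype.one_lt_card_iff_nontrivial.mp this
      exact exists_ne i
    have h1 := hgc i (b i)
    have h2 := hgc i (b j)
    rw [b.coord_apply_eq] at h1
    rw [b.coord_apply_ne (Ne.symm hj)] at h2
    simp only [h0, inner_zero_left] at h1 h2
    linarith
  · rw [← hb] at hx ⊢
    rw [b.interior_convexHull]
    rw [b.convexHull_eq_nonneg_coord] at hx
    intro i
    refine lt_of_le_of_ne (hx i) fun h => hZ _ ⟨i, rfl⟩ ?_
    have := hgc i x
    simp only
    linarith

theorem isClosed_convexHull_finset (s : Finset Plane) :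
    IsClosed (convexHull ℝ (s : Set Plane)) :=
  (s.finite_toSet.isCompact_convexHull ℝ).isClosed

/-! ### Covering and overlap of the triangles; the gradient of the error -/

section Triangulation

variable {T : Geometry.SimplicialComplex ℝ Plane} {Ω : Set Plane}

theorem elements_finite (hT : IsTriangulation T Ω) : (elements T).Finite :=
  hT.1.subset fun _ h => h.1

theorem convexHull_subset_closure (hT : IsTriangulation T Ω) {K : Finset Plane}
    (hK : K ∈ elements T) : convexHull ℝ (K : Set Plane) ⊆ closure Ω := by
  rw [← hT.2]; exact Geometry.SimplicialComplex.convexHull_subset_space hK.1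

/-- The triangles alone cover the closure of the domain. -/
theorem closure_subset_iUnion_elements (hT : IsTriangulation T Ω) (hΩ : IsOpen Ω) :
    closure Ω ⊆ ⋃ K ∈ elements T, convexHull ℝ (K : Set Plane) := by
  have hcl : IsClosed (⋃ K ∈ elements T, convexHull ℝ (K : Set Plane)) :=
    (elements_finite hT).isClosed_biUnion fun K _ => isClosed_convexHull_finset K
  refine closure_minimal ?_ hcl
  -- The part of Ω missed by the triangles is open and lies in finitely many degenerate simplices,
  -- so it is null and therefore empty.
  have hopen : IsOpen (Ω \ ⋃ K ∈ elements T, convexHull ℝ (K : Set Plane)) := hΩ.sdiff hcl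
  rw [← Set.sdiff_eq_empty, ← hopen.measure_eq_zero_iff volume]
  refine measure_mono_null (t := ⋃ K ∈ T.faces \ elements T, convexHull ℝ (K : Set Plane)) ?_ ?_
  · rintro x ⟨hx, hx'⟩
    have : x ∈ T.space := hT.2 ▸ subset_closure hx
    obtain ⟨K, hK, hxK⟩ := Geometry.SimplicialComplex.mem_space_iff.1 this
    refine Set.mem_biUnion (x := K) ⟨hK, fun hK' => hx' ?_⟩ hxK
    exact Set.mem_biUnion hK' hxK
  · refine (measure_biUnion_null_iff (hT.1.subset Set.sdiff_subset).countable).2 fun K hK => ?_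
    refine volume_convexHull_eq_zero ?_
    have h3 := card_le_three hK.1
    have : K.card ≠ 3 := fun h => hK.2 ⟨hK.1, h⟩
    omega

/-- Two faces of the complex meet inside the hull of their common vertices, and distinct triangles
share at most two. -/
theorem aedisjoint_elements {K K' : Finset Plane} (hK : K ∈ elements T) (hK' : K' ∈ elements T)
    (hne : K ≠ K') :
    AEDisjoint volume (convexHull ℝ (K : Set Plane)) (convexHull ℝ (K' : Set Plane)) := by
  classical
  refine measure_mono_null (T.inter_subset_convexHull hK.1 hK'.1) ?_
  rw [← Finset.coe_inter]
  refine volume_convexHull_eq_zero ?_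
  have h1 : K ∩ K' ⊂ K := by
    refine Finset.inter_subset_left.ssubset_of_ne fun h => hne ?_
    exact Finset.eq_of_subset_of_card_le (Finset.inter_eq_left.1 h) (by rw [hK.2, hK'.2])
  have := Finset.card_lt_card h1
  have := hK.2
  omega

theorem volume_closure_diff (hΩ : IsPolygonalLipschitzDomain Ω) :
    volume (closure Ω \ Ω) = 0 := by
  classical
  obtain ⟨S, hS, hsub⟩ := hΩ.polygonal
  rw [← hΩ.isOpen.frontier_eq]
  refine measure_mono_null hsub ((measure_biUnion_null_iff hS.countable).2 fun p _ => ?_)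
  rw [← convexHull_pair]
  have := volume_convexHull_eq_zero (s := {p.1, p.2}) Finset.card_le_two
  simpa using this

theorem restrict_closure_eq (hΩ : IsPolygonalLipschitzDomain Ω) :
    (volume : Measure Plane).restrict (closure Ω) = volume.restrict Ω := by
  refine Measure.restrict_congr_set ?_
  refine (Filter.EventuallyEq.symm ?_)
  refine Filter.EventuallyLE.antisymm (Filter.Eventually.of_forall subset_closure) ?_
  exact ae_le_set.2 (volume_closure_diff hΩ)

theorem quadratic_eq_norm_sq (x : Plane) : quadratic x = ‖x‖ ^ 2 := by
  simp [quadratic, EuclideanSpace.norm_sq_eq, Fin.sum_univ_two]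

/-- The gradient of `u - U` inside a triangle on which `U` is affine with gradient `g`. -/
theorem hasGradientAt_quadratic_sub {U : Plane → ℝ} {s : Set Plane} {g : Plane} {c : ℝ}
    (hU : ∀ x ∈ s, U x = inner ℝ g x + c) {x : Plane} (hx : x ∈ interior s) :
    HasGradientAt (fun y => quadratic y - U y) ((2 : ℝ) • x - g) x := by
  have h1 : HasGradientAt (fun y : Plane => ‖y‖ ^ 2 - (inner ℝ g y + c)) ((2 : ℝ) • x - g) x := by
    rw [hasGradientAt_iff_hasFDerivAt]
    have h2 : HasFDerivAt (fun y : Plane => ‖y‖ ^ 2) (2 • innerSL ℝ x) x :=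
      (hasStrictFDerivAt_norm_sq x).hasFDerivAt
    have h3 : HasFDerivAt (fun y : Plane => inner ℝ g y + c) (innerSL ℝ g) x :=
      ((innerSL ℝ g).hasFDerivAt).add_const c
    have h4 : (InnerProductSpace.toDual ℝ Plane) ((2 : ℝ) • x - g) =
        2 • innerSL ℝ x - innerSL ℝ g := by
      ext y
      simp
    rw [h4]
    exact h2.sub h3
  refine h1.congr_of_eventuallyEq ?_
  filter_upwards [isOpen_interior.mem_nhds hx] with y hy
  simp only [quadratic_eq_norm_sq, hU y (interior_subset hy)]

end Triangulation

/-! ### From second differences on a line to the gradient on a parallelogram -/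

theorem measurable_gradient (w : Plane → ℝ) : Measurable (gradient w) :=
  (InnerProductSpace.toDual ℝ Plane).symm.continuous.measurable.comp (measurable_fderiv ℝ w)

/-- A line meets finitely many lines, none of which contains it, in finitely many points. -/
theorem finite_line_inter {Z : Set (Plane × ℝ)} (hZ : Z.Finite) (q e : Plane)
    (h : ∀ z ∈ Z, inner ℝ z.1 e = 0 → inner ℝ z.1 q ≠ z.2) :
    {τ : ℝ | ∃ z ∈ Z, inner ℝ z.1 (q + τ • e) = z.2}.Finite := by
  have : {τ : ℝ | ∃ z ∈ Z, inner ℝ z.1 (q + τ • e) = z.2} =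
      ⋃ z ∈ Z, {τ : ℝ | inner ℝ z.1 (q + τ • e) = z.2} := by ext; simp
  rw [this]
  refine hZ.biUnion fun z hz => Set.Subsingleton.finite fun τ hτ σ hσ => ?_
  simp only [Set.mem_ofPred_eq, inner_add_right, inner_smul_right] at hτ hσ
  by_cases h0 : inner ℝ z.1 e = 0
  · exact absurd (by simpa [h0] using hτ) (h z hz h0)
  · exact mul_right_cancel₀ h0 (by linarith)

/-- The increment of a piecewise differentiable function along a segment is bounded by the
integral of its gradient. -/
theorem enorm_sub_le_lintegral_gradient {w : Plane → ℝ} {q v : Plane} {σ ρ M : ℝ} (hρ : σ ≤ ρ)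
    {F : Set ℝ} (hF : F.Finite)
    (hcont : ContinuousOn (fun τ : ℝ => w (q + τ • v)) (Set.Icc σ ρ))
    (hdiff : ∀ τ ∈ Set.Icc σ ρ, τ ∉ F → DifferentiableAt ℝ w (q + τ • v) ∧
      ‖gradient w (q + τ • v)‖ ≤ M) :
    ‖w (q + ρ • v) - w (q + σ • v)‖ₑ ≤
      ‖v‖ₑ * ∫⁻ τ in Set.Icc σ ρ, ‖gradient w (q + τ • v)‖ₑ := by
  have hline : Continuous fun τ : ℝ => q + τ • v := by fun_prop
  have hgm : Measurable fun τ : ℝ => gradient w (q + τ • v) :=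
    (measurable_gradient w).comp hline.measurable
  have hm : Measurable fun τ : ℝ => inner ℝ (gradient w (q + τ • v)) v := hgm.inner_const
  have key : ∫ τ in σ..ρ, inner ℝ (gradient w (q + τ • v)) v =
      w (q + ρ • v) - w (q + σ • v) := by
    refine integral_eq_of_hasDerivAt_off_countable (fun τ => w (q + τ • v)) _ hF.countable
      (by rwa [Set.uIcc_of_le hρ]) ?_ ?_
    · rintro τ ⟨hτ, hτF⟩
      rw [min_eq_left hρ, max_eq_right hρ] at hτ
      have h1 := (hdiff τ (Set.Ioo_subset_Icc_self hτ) hτF).1.hasGradientAt.hasFDerivAt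
      have h2 : HasDerivAt (fun τ : ℝ => q + τ • v) v τ := by
        simpa using ((hasDerivAt_id τ).smul_const v).const_add q
      have h3 := h1.comp_hasDerivAt τ h2
      rwa [InnerProductSpace.toDual_apply_apply] at h3
    · rw [intervalIntegrable_iff_integrableOn_Ioc_of_le hρ]
      refine Measure.integrableOn_of_bounded (M := M * ‖v‖) (by simp)
        hm.aestronglyMeasurable ?_
      have hF0 : ∀ᵐ τ : ℝ ∂volume, τ ∉ F := by
        simpa using measure_eq_zero_iff_ae_notMem.1 (hF.measure_zero volume)
      filter_upwards [ae_restrict_mem measurableSet_Ioc, ae_restrict_of_ae hF0] with τ hτ hτF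
      exact (norm_inner_le_norm _ _).trans (mul_le_mul_of_nonneg_right
        (hdiff τ (Set.Ioc_subset_Icc_self hτ) hτF).2 (norm_nonneg v))
  rw [← key, intervalIntegral.integral_of_le hρ, ← lintegral_const_mul _ hgm.enorm]
  refine (enorm_integral_le_lintegral_enorm _).trans
    ((lintegral_mono_set Set.Ioc_subset_Icc_self).trans (lintegral_mono fun τ => ?_))
  rw [← ofReal_norm, ← ofReal_norm, ← ofReal_norm,
    ← ENNReal.ofReal_mul (norm_nonneg _), mul_comm]
  exact ENNReal.ofReal_le_ofReal (norm_inner_le_norm _ _)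

/-- The determinant of two plane vectors. -/
def det₂ (d v : Plane) : ℝ := d 0 * v 1 - d 1 * v 0

/-- Change of variables to the oblique coordinates `(s, t) ↦ p + s d + t v`. -/
theorem lintegral_oblique_le {φ : Plane → ENNReal} (hφ : Measurable φ) {X : Set Plane}
    (hXm : MeasurableSet X) {p d v : Plane} (hdet : det₂ d v ≠ 0) {S S' : Set ℝ}
    (hS : MeasurableSet S) (hS' : MeasurableSet S')
    (hX : ∀ s ∈ S, ∀ t ∈ S', p + s • d + t • v ∈ X) :
    ∫⁻ s in S, ∫⁻ t in S', φ (p + s • d + t • v) ≤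
      ENNReal.ofReal |(det₂ d v)⁻¹| * ∫⁻ x in X, φ x := by
  let A : Plane →ₗ[ℝ] Plane := Matrix.toLpLin 2 2 !![d 0, v 0; d 1, v 1]
  have hA : ∀ y : Plane, A y = y 0 • d + y 1 • v := by
    intro y
    ext i
    fin_cases i <;> simp [A, Matrix.toLpLin_apply, dotProduct, Fin.sum_univ_two,
      mul_comm]
  have hAdet : LinearMap.det A = det₂ d v := by
    simp only [A, Matrix.toLpLin_eq_toLin, LinearMap.det_toLin, Matrix.det_fin_two_of, det₂]
    ring
  have hAdet0 : LinearMap.det A ≠ 0 := by rwa [hAdet]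
  -- Extension by zero off `X` lets the linear change of variables run over the whole plane.
  have hψ : Measurable (X.indicator φ) := hφ.indicator hXm
  have hmap : Continuous fun z : ℝ × ℝ => p + z.1 • d + z.2 • v := by fun_prop
  have hψ₁ : Measurable fun z : ℝ × ℝ => X.indicator φ (p + z.1 • d + z.2 • v) :=
    hψ.comp hmap.measurable
  have hψ₂ : Measurable fun y : Plane => X.indicator φ (p + y) :=
    hψ.comp (measurable_const_add p)
  calc ∫⁻ s in S, ∫⁻ t in S', φ (p + s • d + t • v)
      = ∫⁻ s in S, ∫⁻ t in S', X.indicator φ (p + s • d + t • v) := by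
        refine setLIntegral_congr_fun hS fun s hs => setLIntegral_congr_fun hS' fun t ht => ?_
        simp only [Set.indicator_of_mem (hX s hs t ht)]
    _ ≤ ∫⁻ s, ∫⁻ t, X.indicator φ (p + s • d + t • v) :=
        (setLIntegral_le_lintegral _ _).trans
          (lintegral_mono fun s => setLIntegral_le_lintegral _ _)
    _ = ∫⁻ z : ℝ × ℝ, X.indicator φ (p + z.1 • d + z.2 • v) := by
        rw [Measure.volume_eq_prod, lintegral_prod _ hψ₁.aemeasurable]
    _ = ∫⁻ y : Plane, X.indicator φ (p + A y) := by
        have h1 := (volume_preserving_finTwoArrow ℝ).comp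
          (PiLp.volume_preserving_ofLp (ι := Fin 2))
        rw [← h1.lintegral_comp hψ₁]
        refine lintegral_congr fun y => ?_
        simp [hA, add_assoc]
    _ = ∫⁻ y : Plane, X.indicator φ (p + y) ∂(Measure.map A volume) := by
        rw [lintegral_map hψ₂ (LinearMap.continuous_of_finiteDimensional A).measurable]
    _ = ENNReal.ofReal |(det₂ d v)⁻¹| * ∫⁻ x in X, φ x := by
        rw [Measure.map_linearMap_addHaar_eq_smul_addHaar _ hAdet0, lintegral_smul_measure,
          lintegral_add_left_eq_self (X.indicator φ) p, lintegral_indicator hXm, hAdet,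
          smul_eq_mul]

theorem setLIntegral_Icc_shift_le {G : ℝ → ENNReal} (hG : Measurable G) {a b c : ℝ}
    (hb : 0 ≤ b) (hc : a + b ≤ c) :
    ∫⁻ s in Set.Icc 0 a, G (s + b) ≤ ∫⁻ s in Set.Icc 0 c, G s := by
  rw [← (measurePreserving_add_right volume b).setLIntegral_comp_preimage measurableSet_Icc hG]
  refine lintegral_mono_set fun s hs => ?_
  exact ⟨by linarith [hs.1], by linarith [hs.2]⟩

/-- If all second differences with step `a` of `w` along one side of a parallelogram are at
least `a²`, then the gradient of `w` is not small on the parallelogram. -/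
theorem pow_four_le_lintegral_gradient {X : Set Plane} {w : Plane → ℝ} {Z : Set (Plane × ℝ)}
    (hZ : Z.Finite) (hZ0 : ∀ z ∈ Z, z.1 ≠ 0) (hcont : ContinuousOn w X) {M : ℝ}
    (hdiff : ∀ x ∈ X, (∀ z ∈ Z, inner ℝ z.1 x ≠ z.2) →
      DifferentiableAt ℝ w x ∧ ‖gradient w x‖ ≤ M)
    {p d v : Plane} (hd : ‖d‖ = 1) (hdet : det₂ d v ≠ 0) {a : ℝ} (ha : 0 < a)
    (hX : ∀ s ∈ Set.Icc 0 (3 * a), ∀ t ∈ Set.Icc 0 a, p + s • d + t • v ∈ X)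
    (hD : ∀ s ∈ Set.Icc 0 a, a ^ 2 ≤
      |w (p + (s + 2 * a) • d) - 2 * w (p + (s + a) • d) + w (p + s • d)|) :
    ENNReal.ofReal (a ^ 4) ≤ ENNReal.ofReal (a * (2 + 4 * ‖v‖)) *
      ∫⁻ s in Set.Icc 0 (3 * a), ∫⁻ t in Set.Icc 0 a, ‖gradient w (p + s • d + t • v)‖ₑ := by
  have hindep : ∀ z ∈ Z, inner ℝ z.1 v = 0 → inner ℝ z.1 d ≠ 0 := by
    intro z hz h1 h2
    refine hZ0 z hz ?_
    simp only [PiLp.inner_apply, Fin.sum_univ_two, RCLike.inner_apply, conj_trivial] at h1 h2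
    unfold det₂ at hdet
    ext i
    fin_cases i
    · refine mul_right_cancel₀ hdet ?_
      simp only [Fin.zero_eta, PiLp.zero_apply]
      linear_combination v 1 * h2 - d 1 * h1
    · refine mul_right_cancel₀ hdet ?_
      simp only [Fin.mk_one, PiLp.zero_apply]
      linear_combination d 0 * h1 - v 0 * h2
  -- The exceptional parameters are those for which a line parallel to a side of the parallelogram
  -- is itself a singular line. They are finite in number because no nonzero normal is orthogonal to
  -- both `d` and `v`.
  have hbadS : {s : ℝ | ∃ z ∈ {z ∈ Z | inner ℝ z.1 v = 0},
      inner ℝ z.1 (p + s • d) = z.2}.Finite :=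
    finite_line_inter (hZ.subset (Set.sep_subset _ _)) p d
      fun z hz h => absurd h (hindep z hz.1 hz.2)
  have hbadT : {t : ℝ | ∃ z ∈ {z ∈ Z | inner ℝ z.1 d = 0},
      inner ℝ z.1 (p + t • v) = z.2}.Finite :=
    finite_line_inter (hZ.subset (Set.sep_subset _ _)) p v
      fun z hz h => absurd hz.2 (hindep z hz.1 h)
  set badS := {s : ℝ | ∃ z ∈ {z ∈ Z | inner ℝ z.1 v = 0}, inner ℝ z.1 (p + s • d) = z.2}
  set badT := {t : ℝ | ∃ z ∈ {z ∈ Z | inner ℝ z.1 d = 0}, inner ℝ z.1 (p + t • v) = z.2}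
  let g : ℝ → ℝ → ENNReal := fun s t => ‖gradient w (p + s • d + t • v)‖ₑ
  have hgm : Measurable (Function.uncurry g) := by
    have hmap : Continuous fun z : ℝ × ℝ => p + z.1 • d + z.2 • v := by fun_prop
    exact ((measurable_gradient w).comp hmap.measurable).enorm
  let G₁ : ℝ → ENNReal := fun t => ∫⁻ s in Set.Icc 0 (3 * a), g s t
  let G₂ : ℝ → ENNReal := fun s => ∫⁻ t in Set.Icc 0 a, g s t
  have hG₁ : Measurable G₁ := hgm.lintegral_prod_left'
  have hG₂ : Measurable G₂ := hgm.lintegral_prod_right'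
  have hvert : ∀ s ∈ Set.Icc 0 (3 * a), s ∉ badS → ∀ t ∈ Set.Icc 0 a,
      ‖w (p + s • d + t • v) - w (p + s • d)‖ₑ ≤ ‖v‖ₑ * G₂ s := by
    intro s hs hsb t ht
    have h1 := enorm_sub_le_lintegral_gradient (w := w) (q := p + s • d) (v := v) (σ := 0)
      (ρ := t) (M := M) ht.1 (F := {τ : ℝ | ∃ z ∈ Z, inner ℝ z.1 (p + s • d + τ • v) = z.2})
      (finite_line_inter hZ _ _ fun z hz h0 h => hsb ⟨z, ⟨hz, h0⟩, h⟩)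
      (hcont.comp (by fun_prop) fun τ hτ => hX s hs τ ⟨hτ.1, hτ.2.trans ht.2⟩)
      (fun τ hτ hτF => hdiff _ (hX s hs τ ⟨hτ.1, hτ.2.trans ht.2⟩)
        fun z hz h => hτF ⟨z, hz, h⟩)
    rw [zero_smul, add_zero] at h1
    refine h1.trans (mul_le_mul_right ?_ _)
    exact lintegral_mono_set (Set.Icc_subset_Icc_right ht.2)
  have hhor : ∀ t ∈ Set.Icc 0 a, t ∉ badT → ∀ s s', 0 ≤ s → s ≤ s' → s' ≤ 3 * a →
      ‖w (p + s' • d + t • v) - w (p + s • d + t • v)‖ₑ ≤ ∫⁻ σ in Set.Icc s s', g σ t := by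
    intro t ht htb s s' hs hss hs'
    have hcomm : ∀ σ : ℝ, p + σ • d + t • v = p + t • v + σ • d := fun σ => by abel
    have h1 := enorm_sub_le_lintegral_gradient (w := w) (q := p + t • v) (v := d) (σ := s)
      (ρ := s') (M := M) hss (F := {τ : ℝ | ∃ z ∈ Z, inner ℝ z.1 (p + t • v + τ • d) = z.2})
      (finite_line_inter hZ _ _ fun z hz h0 h => htb ⟨z, ⟨hz, h0⟩, h⟩)
      (hcont.comp (by fun_prop) fun τ hτ => by
        have := hX τ ⟨hs.trans hτ.1, hτ.2.trans hs'⟩ t ht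
        rwa [hcomm] at this)
      (fun τ hτ hτF => hdiff _ (by
        have := hX τ ⟨hs.trans hτ.1, hτ.2.trans hs'⟩ t ht
        rwa [hcomm] at this) fun z hz h => hτF ⟨z, hz, h⟩)
    have hd1 : ‖d‖ₑ = 1 := by rw [← ofReal_norm, hd, ENNReal.ofReal_one]
    rw [hd1, one_mul] at h1
    simpa only [g, hcomm] using h1
  let H : ℝ → ENNReal := fun s => ‖v‖ₑ * (G₂ s + 2 * G₂ (s + a) + G₂ (s + 2 * a))
  have hHm : Measurable H :=
    ((hG₂.add ((hG₂.comp (measurable_add_const a)).const_mul 2)).add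
      (hG₂.comp (measurable_add_const (2 * a)))).const_mul _
  have hpt : ∀ s ∈ Set.Icc 0 a, s ∉ badS → s + a ∉ badS → s + 2 * a ∉ badS →
      ∀ t ∈ Set.Icc 0 a, t ∉ badT → ENNReal.ofReal (a ^ 2) ≤ 2 * G₁ t + H s := by
    intro s hs hs0 hs1 hs2 t ht htb
    have v0 := hvert s ⟨hs.1, by linarith [hs.2]⟩ hs0 t ht
    have v1 := hvert (s + a) ⟨by linarith [hs.1], by linarith [hs.2]⟩ hs1 t ht
    have v2 := hvert (s + 2 * a) ⟨by linarith [hs.1], by linarith [hs.2]⟩ hs2 t ht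
    have h1 := (hhor t ht htb s (s + a) hs.1 (by linarith) (by linarith [hs.2])).trans
      (lintegral_mono_set (Set.Icc_subset_Icc hs.1 (by linarith [hs.2] : s + a ≤ 3 * a)))
    have h2 := (hhor t ht htb (s + a) (s + 2 * a) (by linarith [hs.1]) (by linarith)
      (by linarith [hs.2])).trans (lintegral_mono_set
        (Set.Icc_subset_Icc (by linarith [hs.1] : 0 ≤ s + a)
          (by linarith [hs.2] : s + 2 * a ≤ 3 * a)))
    -- The second difference on the side `t = 0` is carried to height `t`, where it is a difference
    -- of two horizontal increments. The cost is an increment along `v` at each of the three points,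
    -- with weights 1, 2, 1. The shift is needed because the side itself may consist of edges, where
    -- `w` need not be differentiable.
    have hsplit : w (p + (s + 2 * a) • d) - 2 * w (p + (s + a) • d) + w (p + s • d) =
        (w (p + (s + 2 * a) • d + t • v) - w (p + (s + a) • d + t • v)) -
        (w (p + (s + a) • d + t • v) - w (p + s • d + t • v)) -
        (w (p + s • d + t • v) - w (p + s • d)) +
        (2 : ℝ) * (w (p + (s + a) • d + t • v) - w (p + (s + a) • d)) -
        (w (p + (s + 2 * a) • d + t • v) - w (p + (s + 2 * a) • d)) := by ring
    have h2e : ‖(2 : ℝ)‖ₑ = 2 := by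
      rw [Real.enorm_eq_ofReal zero_le_two]; simp
    calc ENNReal.ofReal (a ^ 2)
        ≤ ‖w (p + (s + 2 * a) • d) - 2 * w (p + (s + a) • d) + w (p + s • d)‖ₑ := by
          rw [Real.enorm_eq_ofReal_abs]; exact ENNReal.ofReal_le_ofReal (hD s hs)
      _ ≤ G₁ t + G₁ t + ‖v‖ₑ * G₂ s + 2 * (‖v‖ₑ * G₂ (s + a)) + ‖v‖ₑ * G₂ (s + 2 * a) := by
          rw [hsplit]
          refine (enorm_sub_le).trans (add_le_add ?_ v2)
          refine (enorm_add_le _ _).trans (add_le_add ?_ ?_)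
          · refine (enorm_sub_le).trans (add_le_add ?_ v0)
            exact (enorm_sub_le).trans (add_le_add h2 h1)
          · rw [enorm_mul, h2e]; gcongr
      _ = 2 * G₁ t + H s := by simp only [H]; ring
  -- The pointwise bound is integrated over `s, t ∈ [0, a]`; the exceptional parameters form null
  -- sets.
  have hint : ENNReal.ofReal a * ENNReal.ofReal a * ENNReal.ofReal (a ^ 2) ≤
      ENNReal.ofReal a * (2 * ∫⁻ t in Set.Icc 0 a, G₁ t) +
        ENNReal.ofReal a * ∫⁻ s in Set.Icc 0 a, H s := by
    have hnull : ∀ b : ℝ, ∀ᵐ s : ℝ ∂volume, s + b ∉ badS := fun b => by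
      have hfin : {s : ℝ | s + b ∈ badS}.Finite :=
        hbadS.preimage (add_left_injective b).injOn
      exact measure_eq_zero_iff_ae_notMem.1 (hfin.measure_zero volume)
    have hnull0 : ∀ᵐ s : ℝ ∂volume, s ∉ badS :=
      measure_eq_zero_iff_ae_notMem.1 (hbadS.measure_zero volume)
    have hnullT : ∀ᵐ t : ℝ ∂volume, t ∉ badT :=
      measure_eq_zero_iff_ae_notMem.1 (hbadT.measure_zero volume)
    have hvol : volume (Set.Icc 0 a) = ENNReal.ofReal a := by simp
    calc ENNReal.ofReal a * ENNReal.ofReal a * ENNReal.ofReal (a ^ 2)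
        = ∫⁻ s in Set.Icc 0 a, ∫⁻ t in Set.Icc 0 a, ENNReal.ofReal (a ^ 2) := by
          simp only [lintegral_const, Measure.restrict_apply_univ, hvol]
          ring
      _ ≤ ∫⁻ s in Set.Icc 0 a, ∫⁻ t in Set.Icc 0 a, (2 * G₁ t + H s) := by
          refine lintegral_mono_ae ?_
          filter_upwards [ae_restrict_mem measurableSet_Icc, ae_restrict_of_ae hnull0,
            ae_restrict_of_ae (hnull a), ae_restrict_of_ae (hnull (2 * a))] with s hs h0 h1 h2
          refine lintegral_mono_ae ?_
          filter_upwards [ae_restrict_mem measurableSet_Icc, ae_restrict_of_ae hnullT]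
            with t ht htb
          exact hpt s hs h0 h1 h2 t ht htb
      _ = _ := by
          simp only [lintegral_add_right _ measurable_const, lintegral_const,
            Measure.restrict_apply_univ, hvol]
          rw [lintegral_add_left measurable_const, lintegral_const, lintegral_const_mul _ hG₁,
            lintegral_mul_const _ hHm]
          simp only [Measure.restrict_apply_univ, hvol]
          ring
  have hI₁ : ∫⁻ t in Set.Icc 0 a, G₁ t = ∫⁻ s in Set.Icc 0 (3 * a), G₂ s :=
    lintegral_lintegral_swap (hgm.comp measurable_swap).aemeasurable
  have hIH : ∫⁻ s in Set.Icc 0 a, H s ≤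
      ‖v‖ₑ * (4 * ∫⁻ s in Set.Icc 0 (3 * a), G₂ s) := by
    have e1 : Measurable fun s => G₂ (s + a) := hG₂.comp (measurable_add_const a)
    have e2 : Measurable fun s => G₂ (s + 2 * a) := hG₂.comp (measurable_add_const (2 * a))
    have e3 : Measurable fun s => G₂ s + 2 * G₂ (s + a) + G₂ (s + 2 * a) :=
      (hG₂.add (e1.const_mul 2)).add e2
    simp only [H]
    rw [lintegral_const_mul _ e3, lintegral_add_right _ e2,
      lintegral_add_left hG₂, lintegral_const_mul _ e1]
    gcongr
    calc _ ≤ (∫⁻ s in Set.Icc 0 (3 * a), G₂ s) + 2 * (∫⁻ s in Set.Icc 0 (3 * a), G₂ s) +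
          ∫⁻ s in Set.Icc 0 (3 * a), G₂ s := by
          refine add_le_add (add_le_add ?_ (mul_le_mul_right ?_ _)) ?_
          · exact lintegral_mono_set (Set.Icc_subset_Icc_right (by linarith))
          · exact setLIntegral_Icc_shift_le hG₂ ha.le (by linarith)
          · exact setLIntegral_Icc_shift_le hG₂ (by linarith) (by linarith)
      _ = 4 * ∫⁻ s in Set.Icc 0 (3 * a), G₂ s := by ring
  have hfin := hint.trans (add_le_add_right (mul_le_mul_right hIH _) _)
  rw [hI₁] at hfin
  calc ENNReal.ofReal (a ^ 4)
      = ENNReal.ofReal a * ENNReal.ofReal a * ENNReal.ofReal (a ^ 2) := by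
        rw [← ENNReal.ofReal_mul ha.le, ← ENNReal.ofReal_mul (by positivity)]
        congr 1; ring
    _ ≤ _ := hfin
    _ = _ := by
        rw [ENNReal.ofReal_mul ha.le, ENNReal.ofReal_add (by norm_num) (by positivity),
          ENNReal.ofReal_mul (by norm_num), ofReal_norm, ENNReal.ofReal_ofNat,
          ENNReal.ofReal_ofNat]
        simp only [G₂, g]
        ring

theorem lintegral_const_add_const_mul {G : ℝ → ℝ → ENNReal} (hG : Measurable (Function.uncurry G))
    (S S' : Set ℝ) (c k : ENNReal) :
    ∫⁻ s in S, ∫⁻ t in S', (c + k * G s t) =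
      c * volume S' * volume S + k * ∫⁻ s in S, ∫⁻ t in S', G s t := by
  have h1 : ∀ s, Measurable (G s) := fun s => hG.of_uncurry_left
  have h2 : Measurable fun s => ∫⁻ t in S', G s t := hG.lintegral_prod_right'
  rw [← lintegral_const_mul _ h2, ← setLIntegral_const, ← lintegral_add_left measurable_const]
  refine lintegral_congr fun s => ?_
  rw [lintegral_add_left measurable_const, lintegral_const_mul _ (h1 s), setLIntegral_const]

/-- Young's inequality `G ≤ ε + G ^ 2 / (4 * ε)` plays the part of Cauchy–Schwarz, with `ε` left
free so that the constant term can later be absorbed. -/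
theorem lintegral_le_of_lintegral_sq_le {G : ℝ → ℝ → ℝ} (hG : Measurable (Function.uncurry G))
    {a ε q : ℝ} (ha : 0 ≤ a) (hε : 0 < ε) (hq : 0 ≤ q)
    (h : ∫⁻ s in Set.Icc 0 (3 * a), ∫⁻ t in Set.Icc 0 a, ENNReal.ofReal (G s t ^ 2) ≤
      ENNReal.ofReal q) :
    ∫⁻ s in Set.Icc 0 (3 * a), ∫⁻ t in Set.Icc 0 a, ENNReal.ofReal (G s t) ≤
      ENNReal.ofReal (3 * a * a * ε + (4 * ε)⁻¹ * q) := by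
  have hpt : ∀ s t : ℝ, ENNReal.ofReal (G s t) ≤
      ENNReal.ofReal ε + ENNReal.ofReal (4 * ε)⁻¹ * ENNReal.ofReal (G s t ^ 2) := by
    intro s t
    rw [← ENNReal.ofReal_mul (by positivity), ← ENNReal.ofReal_add hε.le (by positivity)]
    refine ENNReal.ofReal_le_ofReal ?_
    have h1 : ε + (4 * ε)⁻¹ * G s t ^ 2 - G s t = (4 * ε)⁻¹ * (G s t - 2 * ε) ^ 2 := by
      field_simp; ring
    have h0 : 0 ≤ (4 * ε)⁻¹ * (G s t - 2 * ε) ^ 2 := by positivity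
    linarith
  have hm : Measurable (Function.uncurry fun s t => ENNReal.ofReal (G s t ^ 2)) :=
    (hG.pow_const 2).ennreal_ofReal
  refine (lintegral_mono fun s => lintegral_mono fun t => hpt s t).trans ?_
  rw [lintegral_const_add_const_mul hm, Real.volume_Icc, Real.volume_Icc, sub_zero, sub_zero,
    ENNReal.ofReal_add (by positivity) (by positivity),
    ENNReal.ofReal_mul (q := q) (by positivity), ← ENNReal.ofReal_mul hε.le,
    ← ENNReal.ofReal_mul (by positivity)]
  refine add_le_add (le_of_eq (by congr 1; ring)) (mul_le_mul_right h _)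

/-- Quadratic form of `pow_four_le_lintegral_gradient`. -/
theorem pow_four_le_integral_gradient_sq {X : Set Plane} (hXm : MeasurableSet X) {w : Plane → ℝ}
    {Z : Set (Plane × ℝ)}
    (hZ : Z.Finite) (hZ0 : ∀ z ∈ Z, z.1 ≠ 0) (hcont : ContinuousOn w X) {M : ℝ}
    (hdiff : ∀ x ∈ X, (∀ z ∈ Z, inner ℝ z.1 x ≠ z.2) →
      DifferentiableAt ℝ w x ∧ ‖gradient w x‖ ≤ M)
    (hint : IntegrableOn (fun x => ‖gradient w x‖ ^ 2) X)
    {p d v : Plane} (hd : ‖d‖ = 1) (hdet : det₂ d v ≠ 0) {a : ℝ} (ha : 0 < a)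
    (hX : ∀ s ∈ Set.Icc 0 (3 * a), ∀ t ∈ Set.Icc 0 a, p + s • d + t • v ∈ X)
    (hD : ∀ s ∈ Set.Icc 0 a, a ^ 2 ≤
      |w (p + (s + 2 * a) • d) - 2 * w (p + (s + a) • d) + w (p + s • d)|) :
    a ^ 4 ≤ 3 * (2 + 4 * ‖v‖) ^ 2 / |det₂ d v| * ∫ x in X, ‖gradient w x‖ ^ 2 := by
  have h1 := pow_four_le_lintegral_gradient hZ hZ0 hcont hdiff hd hdet ha hX hD
  set b := 2 + 4 * ‖v‖ with hb
  have hb0 : 0 < b := by positivity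
  have hdet0 : 0 < |det₂ d v| := abs_pos.2 hdet
  set Q := ∫ x in X, ‖gradient w x‖ ^ 2 with hQ
  have hQ0 : 0 ≤ Q := integral_nonneg fun x => by positivity
  -- With this choice the constant term of Young's inequality contributes exactly `a ^ 4 / 2`, which
  -- the left side absorbs.
  set ε := a / (6 * b) with hε
  have hε0 : 0 < ε := by positivity
  have hφm : Measurable fun x => ENNReal.ofReal (‖gradient w x‖ ^ 2) :=
    ((measurable_gradient w).norm.pow_const 2).ennreal_ofReal
  have h2 := lintegral_oblique_le hφm hXm hdet (p := p) measurableSet_Icc measurableSet_Icc hX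
  have hQe : ∫⁻ x in X, ENNReal.ofReal (‖gradient w x‖ ^ 2) = ENNReal.ofReal Q :=
    (ofReal_integral_eq_lintegral_ofReal hint
      (Filter.Eventually.of_forall fun x => by positivity)).symm
  rw [hQe, ← ENNReal.ofReal_mul (abs_nonneg _)] at h2
  clear_value Q ε b
  have hmap : Continuous fun z : ℝ × ℝ => p + z.1 • d + z.2 • v := by fun_prop
  have hI := lintegral_le_of_lintegral_sq_le
    (G := fun s t => ‖gradient w (p + s • d + t • v)‖)
    ((measurable_gradient w).comp hmap.measurable).norm ha.le hε0
    (mul_nonneg (abs_nonneg _) hQ0) h2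
  simp only [ofReal_norm] at hI
  have h3 := h1.trans (mul_le_mul_right hI _)
  rw [← ENNReal.ofReal_mul (by positivity), ENNReal.ofReal_le_ofReal_iff (by positivity)] at h3
  have h4 : a * b * (3 * a * a * ε + (4 * ε)⁻¹ * (|(det₂ d v)⁻¹| * Q)) =
      a ^ 4 / 2 + (3 * b ^ 2 / |det₂ d v| * Q) / 2 := by
    rw [hε, abs_inv]; field_simp; ring
  linarith

/-! ### Directions pointing into a Lipschitz domain -/

theorem det₂_sq (d v : Plane) : det₂ d v ^ 2 = ‖d‖ ^ 2 * ‖v‖ ^ 2 - inner ℝ d v ^ 2 := by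
  simp only [det₂, EuclideanSpace.norm_sq_eq, Fin.sum_univ_two, PiLp.inner_apply,
    RCLike.inner_apply, conj_trivial, Real.norm_eq_abs, sq_abs]
  ring

/-- Near each point of the closure of a Lipschitz domain there are two independent directions
pointing into the domain. -/
theorem exists_local_directions {Ω : Set Plane} (hΩ : IsOpen Ω) (hL : HasLipschitzBoundary Ω)
    {x : Plane} (hx : x ∈ closure Ω) :
    ∃ r > 0, ∃ e e' : Plane, det₂ e e' ≠ 0 ∧ ∀ y ∈ closure Ω, dist y x < r →
      ∀ t ∈ Set.Icc 0 r, y + t • e ∈ closure Ω ∧ y + t • e' ∈ closure Ω := by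
  by_cases hxΩ : x ∈ Ω
  · obtain ⟨r, hr, hball⟩ := Metric.isOpen_iff.1 hΩ x hxΩ
    refine ⟨r / 2, by positivity, !₂[1, 0], !₂[0, 1], by simp [det₂], fun y _ hyx t ht => ?_⟩
    have key : ∀ e : Plane, ‖e‖ = 1 → y + t • e ∈ closure Ω := by
      intro e he
      refine subset_closure (hball ?_)
      rw [Metric.mem_ball]
      calc dist (y + t • e) x ≤ dist (y + t • e) y + dist y x := dist_triangle _ _ _
        _ = t + dist y x := by
          rw [dist_self_add_left, norm_smul, he, mul_one, Real.norm_of_nonneg ht.1]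
        _ < r := by linarith [ht.2]
    exact ⟨key _ (by simp [EuclideanSpace.norm_eq]), key _ (by simp [EuclideanSpace.norm_eq])⟩
  · obtain ⟨R, φ, M, r, hφ, hr, hiff⟩ := hL x (by rw [hΩ.frontier_eq]; exact ⟨hx, hxΩ⟩)
    -- In the graph coordinates, vectors with `0 ≤ e 0` and `M * e 0 < e 1` lead strictly above any
    -- graph of Lipschitz constant `M`; `f` and `f'` are two independent ones.
    set f : Plane := !₂[0, 1] with hf
    set f' : Plane := !₂[1, M + 1] with hf'
    set V := 1 + ‖f‖ + ‖f'‖ with hV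
    have hV0 : 0 < V := by positivity
    -- A point this close to `x`, moved by at most this multiple of a vector of length at most `V`,
    -- stays in the ball of radius `r`.
    refine ⟨r / (1 + V), by positivity, R.symm f, R.symm f', ?_, fun y hy hyx t ht => ?_⟩
    · intro h0
      have := det₂_sq (R.symm f) (R.symm f')
      rw [h0, LinearIsometryEquiv.norm_map, LinearIsometryEquiv.norm_map,
        LinearIsometryEquiv.inner_map_map, ← det₂_sq] at this
      simp [det₂, hf, hf'] at this
    · have hyb : y ∈ Metric.ball x r := by
        refine Metric.mem_ball.2 (hyx.trans_le (div_le_self hr.le (by linarith)))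
      have hyle : φ (R y 0) ≤ R y 1 := by
        have hcl : IsClosed {z : Plane | φ (R z 0) ≤ R z 1} := by
          refine isClosed_le (hφ.continuous.comp ?_) ?_
          · exact (EuclideanSpace.proj (𝕜 := ℝ) (0 : Fin 2)).continuous.comp R.continuous
          · exact (EuclideanSpace.proj (𝕜 := ℝ) (1 : Fin 2)).continuous.comp R.continuous
        have h1 : y ∈ closure (Metric.ball x r ∩ Ω) :=
          Metric.isOpen_ball.inter_closure ⟨hyb, hy⟩
        refine closure_minimal ?_ hcl h1
        rintro z ⟨hz, hzΩ⟩
        exact ((hiff z hz).1 hzΩ).le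
      have key : ∀ e : Plane, ‖e‖ ≤ V → (0 ≤ e 0) → M * e 0 < e 1 →
          y + t • R.symm e ∈ closure Ω := by
        intro e he he0 hlt
        rcases ht.1.eq_or_lt with h0 | h0
        · rw [← h0, zero_smul, add_zero]; exact hy
        refine subset_closure ((hiff _ ?_).2 ?_)
        · rw [Metric.mem_ball]
          calc dist (y + t • R.symm e) x
              ≤ dist (y + t • R.symm e) y + dist y x := dist_triangle _ _ _
            _ = t * ‖e‖ + dist y x := by
              rw [dist_self_add_left, norm_smul, LinearIsometryEquiv.norm_map,
                Real.norm_of_nonneg ht.1]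
            _ < r / (1 + V) * V + r / (1 + V) :=
              add_lt_add_of_le_of_lt (mul_le_mul ht.2 he (norm_nonneg _) (by positivity)) hyx
            _ = r := by field_simp; ring
        · have hR : R (y + t • R.symm e) = R y + t • e := by simp
          rw [hR]
          simp only [PiLp.add_apply, PiLp.smul_apply, smul_eq_mul]
          have h2 := hφ.dist_le_mul (R y 0 + t * e 0) (R y 0)
          rw [Real.dist_eq, Real.dist_eq, add_sub_cancel_left, abs_of_nonneg (mul_nonneg h0.le he0)] at h2
          have h3 := (abs_le.1 h2).2
          have h4 : t * (M * e 0) < t * e 1 := mul_lt_mul_of_pos_left hlt h0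
          nlinarith
      refine ⟨key f (by rw [hV]; linarith [norm_nonneg f']) (by simp [hf]) (by simp [hf]),
        key f' (by rw [hV]; linarith [norm_nonneg f]) (by simp [hf']) (by simp [hf'])⟩

/-- A quantitative, uniform version of `exists_local_directions`: for each unit vector `d` one can
choose the direction transversally to `d`. -/
theorem exists_uniform_direction {Ω : Set Plane} (hΩ : IsPolygonalLipschitzDomain Ω) :
    ∃ r > 0, ∃ κ > 0, ∃ V > 0, ∀ x ∈ closure Ω, ∀ d : Plane, ‖d‖ = 1 →
      ∃ v : Plane, ‖v‖ ≤ V ∧ κ ≤ |det₂ d v| ∧ ∀ y ∈ closure Ω, dist y x < r →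
        ∀ t ∈ Set.Icc 0 r, y + t • v ∈ closure Ω := by
  have hcomp : IsCompact (closure Ω) := hΩ.isBounded.isCompact_closure
  -- Admitting common constants is a property of sets that passes to finite unions, hence from small
  -- balls to the compact closure.
  refine hcomp.induction_on (p := fun S => ∃ r > 0, ∃ κ > 0, ∃ V > 0, ∀ x ∈ S,
    ∀ d : Plane, ‖d‖ = 1 → ∃ v : Plane, ‖v‖ ≤ V ∧ κ ≤ |det₂ d v| ∧
      ∀ y ∈ closure Ω, dist y x < r → ∀ t ∈ Set.Icc 0 r, y + t • v ∈ closure Ω) ?_ ?_ ?_ ?_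
  · exact ⟨1, one_pos, 1, one_pos, 1, one_pos, fun x hx => absurd hx (Set.notMem_empty x)⟩
  · rintro S S' hSS ⟨r, hr, κ, hκ, V, hV, h⟩
    exact ⟨r, hr, κ, hκ, V, hV, fun x hx => h x (hSS hx)⟩
  · rintro S S' ⟨r, hr, κ, hκ, V, hV, h⟩ ⟨r', hr', κ', hκ', V', hV', h'⟩
    refine ⟨min r r', lt_min hr hr', min κ κ', lt_min hκ hκ', max V V', lt_max_of_lt_left hV, ?_⟩
    rintro x (hx | hx) d hd
    · obtain ⟨v, h1, h2, h3⟩ := h x hx d hd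
      exact ⟨v, h1.trans (le_max_left _ _), (min_le_left _ _).trans h2, fun y hy hyx t ht =>
        h3 y hy (hyx.trans_le (min_le_left _ _)) t ⟨ht.1, ht.2.trans (min_le_left _ _)⟩⟩
    · obtain ⟨v, h1, h2, h3⟩ := h' x hx d hd
      exact ⟨v, h1.trans (le_max_right _ _), (min_le_right _ _).trans h2, fun y hy hyx t ht =>
        h3 y hy (hyx.trans_le (min_le_right _ _)) t ⟨ht.1, ht.2.trans (min_le_right _ _)⟩⟩
  · intro x hx
    obtain ⟨r, hr, e, e', hdet, h⟩ := exists_local_directions hΩ.isOpen hΩ.lipschitz hx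
    refine ⟨Metric.ball x (r / 2), mem_nhdsWithin_of_mem_nhds
      (Metric.ball_mem_nhds x (by positivity)), r / 2, by positivity,
      |det₂ e e'| / (1 + ‖e‖ + ‖e'‖), div_pos (abs_pos.2 hdet) (by positivity),
      1 + ‖e‖ + ‖e'‖, by positivity, fun z hz d hd => ?_⟩
    -- Cramer's rule writes `d` in terms of `e` and `e'`, so the unit vector `d` cannot be nearly
    -- parallel to both.
    have hd' : |det₂ e e'| ≤ |det₂ d e'| * ‖e‖ + |det₂ d e| * ‖e'‖ := by
      have h1 : det₂ e e' • d = det₂ d e' • e - det₂ d e • e' := by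
        ext i
        fin_cases i <;> simp [det₂] <;> ring
      calc |det₂ e e'| = ‖det₂ e e' • d‖ := by rw [norm_smul, hd, mul_one, Real.norm_eq_abs]
        _ ≤ ‖det₂ d e' • e‖ + ‖det₂ d e • e'‖ := by rw [h1]; exact norm_sub_le _ _
        _ = _ := by rw [norm_smul, norm_smul, Real.norm_eq_abs, Real.norm_eq_abs]
    have hyz : ∀ y, dist y z < r / 2 → dist y x < r := fun y hy => by
      have := dist_triangle y z x
      have := Metric.mem_ball.1 hz
      linarith
    by_cases hc : |det₂ e e'| / (1 + ‖e‖ + ‖e'‖) ≤ |det₂ d e|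
    · exact ⟨e, by linarith [norm_nonneg e'], hc, fun y hy hyd t ht =>
        (h y hy (hyz y hyd) t ⟨ht.1, by linarith [ht.2]⟩).1⟩
    · refine ⟨e', by linarith [norm_nonneg e], ?_, fun y hy hyd t ht =>
        (h y hy (hyz y hyd) t ⟨ht.1, by linarith [ht.2]⟩).2⟩
      rw [not_le] at hc
      by_contra hc'
      rw [not_le] at hc'
      set κ := |det₂ e e'| / (1 + ‖e‖ + ‖e'‖) with hκ
      have hκe : |det₂ e e'| = κ * (1 + ‖e‖ + ‖e'‖) := by rw [hκ]; field_simp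
      have hκ0 : 0 < κ := (abs_nonneg _).trans_lt hc
      nlinarith [norm_nonneg e, norm_nonneg e']

/-! ### Regularity of the error and elementwise gradient estimates -/

section Triangulation

variable {T : Geometry.SimplicialComplex ℝ Plane} {Ω : Set Plane} {U : Plane → ℝ}

/-- A piecewise linear function has a constant gradient on each triangle. -/
theorem exists_gradients (hU : U ∈ piecewiseLinear T) :
    ∃ (g : Finset Plane → Plane) (c : Finset Plane → ℝ), ∀ K ∈ elements T,
      ∀ x ∈ convexHull ℝ (K : Set Plane), U x = inner ℝ (g K) x + c K := by
  have : ∀ K : Finset Plane, ∃ (g : Plane) (c : ℝ), K ∈ elements T →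
      ∀ x ∈ convexHull ℝ (K : Set Plane), U x = inner ℝ g x + c := by
    intro K
    by_cases hK : K ∈ elements T
    · obtain ⟨f, hf⟩ := hU.2 K hK
      obtain ⟨g, c, hgc⟩ := exists_eq_inner_add f
      exact ⟨g, c, fun _ x hx => (hf hx).trans (hgc x)⟩
    · exact ⟨0, 0, fun h => absurd h hK⟩
  choose g c h using this
  exact ⟨g, c, fun K hK => h K hK⟩

/-- The gradient of `u - U` is bounded inside the triangles. -/
theorem exists_gradient_bound (hΩ : IsPolygonalLipschitzDomain Ω) (hT : IsTriangulation T Ω)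
    (hU : U ∈ piecewiseLinear T) :
    ∃ M : ℝ, ∀ K ∈ elements T, ∀ x ∈ interior (convexHull ℝ (K : Set Plane)),
      DifferentiableAt ℝ (fun y => quadratic y - U y) x ∧
        ‖gradient (fun y => quadratic y - U y) x‖ ≤ M := by
  obtain ⟨g, c, hgc⟩ := exists_gradients hU
  obtain ⟨R, hR⟩ := hΩ.isBounded.closure.exists_norm_le
  have hfin := elements_finite hT
  refine ⟨2 * R + ∑ K ∈ hfin.toFinset, ‖g K‖, fun K hK x hx => ?_⟩
  have hgrad := hasGradientAt_quadratic_sub (hgc K hK) hx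
  refine ⟨hgrad.differentiableAt, ?_⟩
  rw [hgrad.gradient]
  have h1 : ‖x‖ ≤ R := hR x (convexHull_subset_closure hT hK (interior_subset hx))
  have h2 : ‖g K‖ ≤ ∑ K ∈ hfin.toFinset, ‖g K‖ :=
    Finset.single_le_sum (f := fun K => ‖g K‖) (fun _ _ => norm_nonneg _)
      (hfin.mem_toFinset.2 hK)
  calc ‖(2 : ℝ) • x - g K‖ ≤ ‖(2 : ℝ) • x‖ + ‖g K‖ := norm_sub_le _ _
    _ = 2 * ‖x‖ + ‖g K‖ := by rw [norm_smul, Real.norm_ofNat]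
    _ ≤ _ := by linarith

/-- `u - U` is differentiable off finitely many lines, with a bounded gradient. -/
theorem exists_singular_lines (hΩ : IsPolygonalLipschitzDomain Ω) (hT : IsTriangulation T Ω)
    (hU : U ∈ piecewiseLinear T) :
    ∃ Z : Set (Plane × ℝ), Z.Finite ∧ (∀ z ∈ Z, z.1 ≠ 0) ∧ ∃ M : ℝ, ∀ x ∈ closure Ω,
      (∀ z ∈ Z, inner ℝ z.1 x ≠ z.2) →
        DifferentiableAt ℝ (fun y => quadratic y - U y) x ∧
          ‖gradient (fun y => quadratic y - U y) x‖ ≤ M := by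
  obtain ⟨M, hM⟩ := exists_gradient_bound hΩ hT hU
  choose! Z hZfin hZ0 hZ using fun K (hK : K ∈ elements T) =>
    exists_lines_of_affineIndependent (T.indep hK.1) hK.2
  refine ⟨⋃ K ∈ elements T, Z K, (elements_finite hT).biUnion hZfin, ?_, M, fun x hx hxZ => ?_⟩
  · intro z hz
    obtain ⟨K, hK, hzK⟩ := Set.mem_iUnion₂.1 hz
    exact hZ0 K hK z hzK
  · obtain ⟨K, hK, hxK⟩ := Set.mem_iUnion₂.1 (closure_subset_iUnion_elements hT hΩ.isOpen hx)
    exact hM K hK x (hZ K hK x hxK fun z hz => hxZ z (Set.mem_biUnion hK hz))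

theorem ae_mem_interior_of_convex {s : Set Plane} (hs : Convex ℝ s) :
    ∀ᵐ x ∂(volume : Measure Plane), x ∈ s → x ∈ interior s := by
  filter_upwards [measure_eq_zero_iff_ae_notMem.1 (hs.addHaar_frontier volume)] with x hx hxs
  by_contra h
  exact hx ⟨subset_closure hxs, h⟩

/-- Almost every point of the closure is interior to some triangle, where the gradient is bounded.
Integrability matters because the Bochner integral of a nonintegrable function would be 0. -/
theorem integrableOn_gradient_sq (hΩ : IsPolygonalLipschitzDomain Ω) (hT : IsTriangulation T Ω)
    (hU : U ∈ piecewiseLinear T) :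
    IntegrableOn (fun x => ‖gradient (fun y => quadratic y - U y) x‖ ^ 2) (closure Ω) := by
  obtain ⟨M, hM⟩ := exists_gradient_bound hΩ hT hU
  refine Measure.integrableOn_of_bounded (M := M ^ 2) hΩ.isBounded.closure.measure_lt_top.ne
    ((measurable_gradient _).norm.pow_const 2).aestronglyMeasurable ?_
  have h1 : ∀ᵐ x ∂(volume : Measure Plane), ∀ K ∈ elements T,
      x ∈ convexHull ℝ (K : Set Plane) → x ∈ interior (convexHull ℝ (K : Set Plane)) :=
    (ae_ball_iff (elements_finite hT).countable).2 fun K _ =>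
      ae_mem_interior_of_convex (convex_convexHull ℝ _)
  filter_upwards [ae_restrict_of_ae h1, ae_restrict_mem isClosed_closure.measurableSet]
    with x hx hxΩ
  obtain ⟨K, hK, hxK⟩ := Set.mem_iUnion₂.1 (closure_subset_iUnion_elements hT hΩ.isOpen hxΩ)
  rw [norm_pow, norm_norm]
  exact pow_le_pow_left₀ (norm_nonneg _) (hM K hK x (hx K hK hxK)).2 2

/-- Distinct triangles do not overlap, so that integrals over them add up. -/
theorem sum_setIntegral_elements_le (hΩ : IsPolygonalLipschitzDomain Ω)
    (hT : IsTriangulation T Ω) {F : Plane → ℝ} (hF : IntegrableOn F (closure Ω))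
    (hF0 : ∀ x, 0 ≤ F x) {ι : Type*} (s : Finset ι) {k : ι → Finset Plane}
    (hk : ∀ i ∈ s, k i ∈ elements T) (hinj : Set.InjOn k s) :
    ∑ i ∈ s, ∫ x in convexHull ℝ (k i : Set Plane), F x ≤ ∫ x in Ω, F x := by
  have hsub : (⋃ i : s, convexHull ℝ (k i : Set Plane)) ⊆ closure Ω :=
    Set.iUnion_subset fun i => convexHull_subset_closure hT (hk i i.2)
  have h1 := integral_iUnion_ae (μ := volume) (f := F)
    (s := fun i : s => convexHull ℝ (k i : Set Plane))
    (fun i => (isClosed_convexHull_finset _).measurableSet.nullMeasurableSet)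
    (fun i j hij => aedisjoint_elements (hk i i.2) (hk j j.2)
      fun h => hij (Subtype.ext (hinj i.2 j.2 h))) (hF.mono_set hsub)
  rw [tsum_fintype, Finset.univ_eq_attach,
    Finset.sum_attach s fun i => ∫ x in convexHull ℝ (k i : Set Plane), F x] at h1
  rw [← h1, ← restrict_closure_eq hΩ]
  exact setIntegral_mono_set hF (Filter.Eventually.of_forall hF0)
    (Filter.Eventually.of_forall hsub)

/-- The gradient of `U` on a triangle is close to `∇u` at a vertex if the error is small. -/
theorem volume_mul_norm_sub_sq_le (hΩ : IsPolygonalLipschitzDomain Ω) (hT : IsTriangulation T Ω)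
    (hU : U ∈ piecewiseLinear T) {K : Finset Plane} (hK : K ∈ elements T) {g P : Plane} {c δ : ℝ}
    (hg : ∀ x ∈ convexHull ℝ (K : Set Plane), U x = inner ℝ g x + c) (hP : P ∈ K)
    (hδ : Metric.diam (convexHull ℝ (K : Set Plane)) ≤ δ) :
    (volume (convexHull ℝ (K : Set Plane))).toReal * ‖g - (2 : ℝ) • P‖ ^ 2 ≤
      ∫ x in convexHull ℝ (K : Set Plane),
        (2 * ‖gradient (fun y => quadratic y - U y) x‖ ^ 2 + 8 * δ ^ 2) := by
  have hbd : Bornology.IsBounded (convexHull ℝ (K : Set Plane)) :=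
    (K.finite_toSet.isCompact_convexHull ℝ).isBounded
  have hfin : volume (convexHull ℝ (K : Set Plane)) ≠ ⊤ := hbd.measure_lt_top.ne
  have hPK : P ∈ convexHull ℝ (K : Set Plane) := subset_convexHull ℝ _ hP
  have h1 : ∫ _ in convexHull ℝ (K : Set Plane), ‖g - (2 : ℝ) • P‖ ^ 2 =
      (volume (convexHull ℝ (K : Set Plane))).toReal * ‖g - (2 : ℝ) • P‖ ^ 2 := by
    rw [setIntegral_const, smul_eq_mul]; rfl
  rw [← h1]
  refine integral_mono_ae (integrableOn_const hfin) ((((integrableOn_gradient_sq hΩ hT hU).mono_set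
    (convexHull_subset_closure hT hK)).const_mul 2).add (integrableOn_const hfin)) ?_
  filter_upwards [ae_restrict_mem (isClosed_convexHull_finset K).measurableSet,
    ae_restrict_of_ae (ae_mem_interior_of_convex (convex_convexHull ℝ (K : Set Plane)))]
    with x hx hxi
  rw [(hasGradientAt_quadratic_sub hg (hxi hx)).gradient]
  have hdist : ‖x - P‖ ≤ δ := by
    rw [← dist_eq_norm]; exact (Metric.dist_le_diam_of_mem hbd hx hPK).trans hδ
  -- Here `2 • x` is ∇u at `x`, which differs from ∇u at `P` by at most `2 * δ`.
  have h2 : ‖g - (2 : ℝ) • P‖ ≤ ‖(2 : ℝ) • x - g‖ + 2 * δ := by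
    calc ‖g - (2 : ℝ) • P‖ = ‖(2 : ℝ) • (x - P) - ((2 : ℝ) • x - g)‖ := by
          congr 1; rw [smul_sub]; abel
      _ ≤ ‖(2 : ℝ) • (x - P)‖ + ‖(2 : ℝ) • x - g‖ := norm_sub_le _ _
      _ = 2 * ‖x - P‖ + ‖(2 : ℝ) • x - g‖ := by rw [norm_smul, Real.norm_ofNat]
      _ ≤ _ := by linarith
  have h3 := pow_le_pow_left₀ (norm_nonneg _) h2 2
  nlinarith [sq_nonneg (‖(2 : ℝ) • x - g‖ - 2 * δ)]

end Triangulation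

/-! ### Angles and the jump of the slope -/

section Angles

open InnerProductGeometry

theorem abs_det₂ (a b : Plane) : |det₂ a b| = Real.sin (angle a b) * (‖a‖ * ‖b‖) := by
  rw [sin_angle_mul_norm_mul_norm, ← Real.sqrt_sq_eq_abs, det₂_sq, real_inner_self_eq_norm_sq,
    real_inner_self_eq_norm_sq, sq (inner ℝ a b)]

theorem abs_det₂_le (a b : Plane) : |det₂ a b| ≤ ‖a‖ * ‖b‖ := by
  rw [abs_det₂]
  exact mul_le_of_le_one_left (by positivity) (Real.sin_le_one _)

/-- Both vectors are resolved along `e` and along its normal. -/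
theorem inner_mul_norm_sq (a b e : Plane) :
    inner ℝ a b * ‖e‖ ^ 2 = inner ℝ a e * inner ℝ b e + det₂ a e * det₂ b e := by
  simp only [det₂, EuclideanSpace.norm_sq_eq, Fin.sum_univ_two, PiLp.inner_apply,
    RCLike.inner_apply, conj_trivial, Real.norm_eq_abs, sq_abs]
  ring

/-- The sine of the angle at `c` is at most the sine of the largest angle, if the latter is
at `b`. -/
theorem sin_angle_le_of_maxAngle {a b c : Plane} (hab : a ≠ b)
    (h : maxAngle a b c = EuclideanGeometry.angle a b c) :
    Real.sin (EuclideanGeometry.angle a c b) ≤ Real.sin (EuclideanGeometry.angle a b c) := by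
  have hle : EuclideanGeometry.angle a c b ≤ EuclideanGeometry.angle a b c := by
    rw [← h]; exact (le_max_right _ _).trans (le_max_right _ _)
  have hsum := EuclideanGeometry.angle_add_angle_add_angle_eq_pi (p₁ := a) (p₂ := b) c hab.symm
  rw [EuclideanGeometry.angle_comm b c a] at hsum
  have h0 := EuclideanGeometry.angle_nonneg c a b
  have h1 := EuclideanGeometry.angle_nonneg a c b
  have h2 : 0 ≤ Real.sin (EuclideanGeometry.angle a b c) -
      Real.sin (EuclideanGeometry.angle a c b) := by
    -- The sine may decrease beyond π/2, so monotonicity is unavailable. In the product formula the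
    -- half-sum is at most π/2, because two angles of a triangle sum to at most π.
    rw [Real.sin_sub_sin]
    refine mul_nonneg (mul_nonneg zero_le_two (Real.sin_nonneg_of_nonneg_of_le_pi ?_ ?_))
      (Real.cos_nonneg_of_neg_pi_div_two_le_of_le ?_ ?_) <;> linarith [Real.pi_pos]
  linarith

/-- The jump of the slope along a line, from one triangle `QAP` to the next, is controlled by the
gradient on the triangle `APA'` between them. -/
theorem abs_inner_sub_le {Q P A A' d g₀ g₁ gt : Plane} (hd : ‖d‖ = 1) {ℓ : ℝ} (hℓ : 0 < ℓ)
    (hQ : P = Q + ℓ • d) (hA : A ≠ P) (hA' : A' ≠ P) (hAQ : Q ≠ A)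
    (hmax : maxAngle Q A P = EuclideanGeometry.angle Q A P)
    (h₀ : inner ℝ (gt - g₀) (A - P) = 0) (h₁ : inner ℝ (gt - g₁) (A' - P) = 0) :
    |inner ℝ (g₀ - g₁) d| ≤ Real.sin (EuclideanGeometry.angle A P A') * ‖gt - g₁‖ +
      Real.sin (EuclideanGeometry.angle Q A P) * ‖g₀ - g₁‖ := by
  have he : 0 < ‖A - P‖ := norm_pos_iff.2 (sub_ne_zero.2 hA)
  have he' : 0 < ‖A' - P‖ := norm_pos_iff.2 (sub_ne_zero.2 hA')
  set e := A - P with hedef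
  set e' := A' - P with he'def
  have hsin1 : |det₂ d e| ≤ Real.sin (EuclideanGeometry.angle Q A P) * ‖e‖ := by
    have h1 : |det₂ d e| = Real.sin (EuclideanGeometry.angle Q P A) * ‖e‖ := by
      have hQP : Q - P = (-ℓ) • d := by rw [hQ]; module
      rw [abs_det₂, hd, one_mul, EuclideanGeometry.angle, vsub_eq_sub, vsub_eq_sub, hQP,
        angle_smul_left_of_neg _ _ (neg_neg_of_pos hℓ), angle_neg_left, Real.sin_pi_sub]
    rw [h1]
    exact mul_le_mul_of_nonneg_right (sin_angle_le_of_maxAngle hAQ hmax) he.le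
  have hsin2 : |det₂ e e'| = Real.sin (EuclideanGeometry.angle A P A') * (‖e‖ * ‖e'‖) :=
    abs_det₂ e e'
  have hδe : inner ℝ (g₀ - g₁) e = inner ℝ (gt - g₁) e := by
    simp only [inner_sub_left] at h₀ ⊢
    linarith
  -- Since `gt - g₁` is orthogonal to `e'`, it sees only the part of `e` normal to `e'`, of length
  -- the sine of the angle at `P` times `‖e‖`.
  have hb : |inner ℝ (g₀ - g₁) e| ≤
      Real.sin (EuclideanGeometry.angle A P A') * ‖gt - g₁‖ * ‖e‖ := by
    have h2 := inner_mul_norm_sq (gt - g₁) e e'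
    rw [h₁, zero_mul, zero_add] at h2
    rw [hδe]
    refine le_of_mul_le_mul_right ?_ (pow_pos he' 2)
    calc |inner ℝ (gt - g₁) e| * ‖e'‖ ^ 2 = |det₂ (gt - g₁) e'| * |det₂ e e'| := by
          rw [← abs_mul, ← h2, abs_mul, abs_of_nonneg (sq_nonneg ‖e'‖)]
      _ ≤ (‖gt - g₁‖ * ‖e'‖) * |det₂ e e'| :=
          mul_le_mul_of_nonneg_right (abs_det₂_le _ _) (abs_nonneg _)
      _ = _ := by rw [hsin2]; ring
  refine le_of_mul_le_mul_right ?_ (pow_pos he 2)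
  -- The direction `d` is split along `e` and normal to `e`: the first part is controlled by `hb`,
  -- the second is short by `hsin1`.
  calc |inner ℝ (g₀ - g₁) d| * ‖e‖ ^ 2
      = |inner ℝ (g₀ - g₁) e * inner ℝ d e + det₂ (g₀ - g₁) e * det₂ d e| := by
        rw [← inner_mul_norm_sq, abs_mul, abs_of_nonneg (sq_nonneg ‖e‖)]
    _ ≤ |inner ℝ (g₀ - g₁) e| * |inner ℝ d e| + |det₂ (g₀ - g₁) e| * |det₂ d e| := by
        rw [← abs_mul, ← abs_mul]; exact abs_add_le _ _
    _ ≤ (Real.sin (EuclideanGeometry.angle A P A') * ‖gt - g₁‖ * ‖e‖) * ‖e‖ +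
        (‖g₀ - g₁‖ * ‖e‖) * (Real.sin (EuclideanGeometry.angle Q A P) * ‖e‖) := by
        have h3 : |inner ℝ d e| ≤ ‖e‖ := by
          have := abs_real_inner_le_norm d e
          rwa [hd, one_mul] at this
        exact add_le_add
          (mul_le_mul hb h3 (abs_nonneg _) ((abs_nonneg _).trans hb))
          (mul_le_mul (abs_det₂_le _ _) hsin1 (abs_nonneg _) (by positivity))
    _ = _ := by ring

end Angles

/-! ### Oscillation of the slope along the band -/

section Band

variable {T : Geometry.SimplicialComplex ℝ Plane} {Ω : Set Plane} {U : Plane → ℝ}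

theorem not_collinear_of_isElement {a b c : Plane} (h : IsElement T a b c) :
    ¬ Collinear ℝ ({a, b, c} : Set Plane) := by
  obtain ⟨K, hK, hKe⟩ := h
  have h1 := (T.indep hK.1).finrank_vectorSpan (n := 2) (by simp [hK.2])
  rw [Subtype.range_coe_subtype] at h1
  have h2 : {x | x ∈ K} = ({a, b, c} : Set Plane) := by rw [← hKe]; rfl
  rw [h2] at h1
  rw [collinear_iff_finrank_le_one, h1]
  norm_num

/-- Increments of a continuous piecewise linear function of one variable are bounded by its
largest slope. -/
theorem sub_le_of_piecewise_slope {pos t : ℕ → ℝ} {V : ℝ → ℝ} {N : ℕ} {M : ℝ}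
    (hpos : ∀ i ≤ N, pos i < pos (i + 1))
    (hV : ∀ i ≤ N, ∀ s ∈ Set.Icc (pos i) (pos (i + 1)), ∀ s' ∈ Set.Icc (pos i) (pos (i + 1)),
      V s' - V s = t i * (s' - s))
    (hM : ∀ i ≤ N, t i ≤ M) :
    ∀ n ≤ N + 1, ∀ s s', pos 0 ≤ s → s ≤ s' → s' ≤ pos n → V s' - V s ≤ M * (s' - s) := by
  intro n
  induction n with
  | zero =>
    intro _ s s' h0 h1 h2
    have : s' = s := le_antisymm (by linarith) h1
    simp [this]
  | succ n ih =>
    intro hn s s' h0 h1 h2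
    have hlt := hpos n (by omega)
    have hpiece : ∀ x y, pos n ≤ x → x ≤ y → y ≤ pos (n + 1) → V y - V x ≤ M * (y - x) := by
      intro x y hx hxy hy
      rw [hV n (by omega) x ⟨hx, hxy.trans hy⟩ y ⟨hx.trans hxy, hy⟩]
      exact mul_le_mul_of_nonneg_right (hM n (by omega)) (by linarith)
    rcases le_total s' (pos n) with h | h
    · exact ih (by omega) s s' h0 h1 h
    rcases le_total (pos n) s with h' | h'
    · exact hpiece s s' h' h1 h2
    · have e1 := ih (by omega) s (pos n) h0 h' le_rfl
      have e2 := hpiece (pos n) s' le_rfl h h2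
      linarith

theorem pos_lt_pos (B : StraightBand T) {i j : ℕ} (hij : i < j) (hj : j ≤ B.N + 1) :
    B.pos i < B.pos j := by
  induction j with
  | zero => omega
  | succ j ih =>
    have h1 := B.pos_lt j (by omega)
    rcases Nat.lt_succ_iff_lt_or_eq.1 hij with h | rfl
    · exact (ih h (by omega)).trans h1
    · exact h1

theorem eq_of_base_eq (B : StraightBand T) {i j : ℕ} (hi : i ≤ B.N + 1) (hj : j ≤ B.N + 1)
    (h : B.base i = B.base j) : i = j := by
  have hd : B.dir ≠ 0 := by
    rw [← norm_pos_iff, B.norm_dir]; exact one_pos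
  have hp : B.pos i = B.pos j := smul_left_injective ℝ hd (add_left_cancel h)
  rcases lt_trichotomy i j with h' | h' | h'
  · exact absurd hp (pos_lt_pos B h' hj).ne
  · exact h'
  · exact absurd hp.symm (pos_lt_pos B h' hi).ne

/-- An apex on the line would make the vertices of its triangle collinear, against their affine
independence. -/
theorem apex_ne_line (B : StraightBand T) {i : ℕ} (hi : i ≤ B.N) (τ : ℝ) :
    B.apex i ≠ B.start + τ • B.dir := by
  intro h
  refine not_collinear_of_isElement (B.elem i hi)
    ((collinear_iff_exists_forall_eq_smul_vadd _).2 ⟨B.start, B.dir, ?_⟩)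
  intro p hp
  rcases hp with rfl | rfl | rfl
  · exact ⟨_, add_comm _ _⟩
  · exact ⟨τ, by rw [h]; exact add_comm _ _⟩
  · exact ⟨_, add_comm _ _⟩

/-- The part of `Γ` between `P_i` and `P_{i+1}` is an edge of `K_i`. -/
theorem line_mem_triangle (B : StraightBand T) {i : ℕ} {s : ℝ}
    (hs : s ∈ Set.Icc (B.pos i) (B.pos (i + 1))) :
    B.start + s • B.dir ∈ convexHull ℝ {B.base i, B.apex i, B.base (i + 1)} := by
  have hseg : B.start + s • B.dir ∈ segment ℝ (B.base i) (B.base (i + 1)) := by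
    rcases hs.1.eq_or_lt with h | h
    · rw [← h]; exact left_mem_segment ℝ _ _
    have hlt : B.pos i < B.pos (i + 1) := h.trans_le hs.2
    rw [segment_eq_image']
    refine ⟨(s - B.pos i) / (B.pos (i + 1) - B.pos i), ⟨div_nonneg (by linarith) (by linarith),
      (div_le_one (by linarith)).2 (by linarith [hs.2])⟩, ?_⟩
    simp only [StraightBand.base]
    rw [add_sub_add_left_eq_sub, ← sub_smul, smul_smul, div_mul_cancel₀ _ (by linarith), add_assoc,
      ← add_smul]
    congr 2; ring
  exact segment_subset_convexHull (by simp) (by simp) hseg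

theorem line_mem_closure (hT : IsTriangulation T Ω) (B : StraightBand T) {s : ℝ}
    (hs : s ∈ Set.Icc 0 B.length) : B.start + s • B.dir ∈ closure Ω := by
  have key : ∀ n ≤ B.N + 1, ∀ s, B.pos 0 ≤ s → s ≤ B.pos n →
      ∃ i ≤ B.N, s ∈ Set.Icc (B.pos i) (B.pos (i + 1)) := by
    intro n
    induction n with
    | zero =>
      intro _ s h0 h1
      exact ⟨0, Nat.zero_le _, h0, h1.trans (B.pos_lt 0 (Nat.zero_le _)).le⟩
    | succ n ih =>
      intro hn s h0 h1
      rcases le_total s (B.pos n) with h | h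
      · exact ih (by omega) s h0 h
      · exact ⟨n, by omega, h, h1⟩
  obtain ⟨i, hi, his⟩ := key (B.N + 1) le_rfl s (by rw [B.pos_zero]; exact hs.1) hs.2
  obtain ⟨K, hK, hKe⟩ := B.elem i hi
  have h1 := line_mem_triangle B his
  refine convexHull_subset_closure hT hK ?_
  rw [hKe]
  exact h1

/-- If the error is small and the band is long, then the slope of `U` along `Γ` varies by at least
a fixed multiple of the length of `Γ`. -/
theorem exists_slope_oscillation (hΩ : IsPolygonalLipschitzDomain Ω) (α C_u : ℝ) :
    ∃ C_L > (0 : ℝ), ∃ δ > (0 : ℝ), ∀ (h : ℝ) (T : Geometry.SimplicialComplex ℝ Plane)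
      (U : Plane → ℝ) (B : StraightBand T) (t : ℕ → ℝ), 0 < h → IsTriangulation T Ω →
      U ∈ piecewiseLinear T →
      ∫ x in Ω, ‖gradient (fun y => quadratic y - U y) x‖ ^ 2 ≤ C_u ^ 2 * (h ^ α) ^ 2 →
      C_L * h ^ (2 * α / 5) ≤ B.length →
      (∀ i ≤ B.N, ∀ s ∈ Set.Icc (B.pos i) (B.pos (i + 1)),
        ∀ s' ∈ Set.Icc (B.pos i) (B.pos (i + 1)),
        U (B.start + s' • B.dir) - U (B.start + s • B.dir) = t i * (s' - s)) →
      ∃ i ≤ B.N, ∃ j ≤ B.N, δ * B.length < t i - t j := by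
  obtain ⟨r, hr, κ, hκ, V, hV, hdir⟩ := exists_uniform_direction hΩ
  set D := Metric.diam (closure Ω) with hD
  have hD0 : 0 ≤ D := Metric.diam_nonneg
  -- The two bounds make the base of length `3 * a`, with `a = δ * L`, fit into Γ and keep it within
  -- the radius `r` of the uniform inward direction.
  set δ := min (1 / 3) (r / (4 * (D + 1))) with hδ
  have hδ0 : 0 < δ := lt_min (by norm_num) (by positivity)
  set C := 3 * (2 + 4 * V) ^ 2 / κ * C_u ^ 2 with hC
  have hC0 : 0 ≤ C := by positivity
  have hE0 : 0 ≤ (D + 1) * C / δ ^ 4 := by positivity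
  refine ⟨1 + (D + 1) * C / δ ^ 4, by positivity, δ, hδ0, ?_⟩
  intro h T U B t hh hT hU hint hL hslope
  by_contra! hcon
  have hLpos : 0 < B.length :=
    lt_of_lt_of_le (mul_pos (by linarith) (Real.rpow_pos_of_pos hh _)) hL
  set L := B.length with hLdef
  have hmem : ∀ s ∈ Set.Icc 0 L, B.start + s • B.dir ∈ closure Ω :=
    fun s hs => line_mem_closure hT B hs
  have hstart : B.start ∈ closure Ω := by
    simpa using hmem 0 ⟨le_rfl, hLpos.le⟩
  have hLD : L ≤ D := by
    have := Metric.dist_le_diam_of_mem hΩ.isBounded.closure (hmem L ⟨hLpos.le, le_rfl⟩) hstart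
    rwa [dist_self_add_left, norm_smul, B.norm_dir, mul_one, Real.norm_of_nonneg hLpos.le] at this
  set a := δ * L with ha
  have ha0 : 0 < a := mul_pos hδ0 hLpos
  have haL : 3 * a ≤ L := by
    have : δ ≤ 1 / 3 := min_le_left _ _
    rw [ha]; nlinarith
  have har : 3 * a < r := by
    have h1 : δ ≤ r / (4 * (D + 1)) := min_le_right _ _
    have h2 : δ * (4 * (D + 1)) ≤ r := (le_div_iff₀ (by positivity)).1 h1
    rw [ha]
    nlinarith
  obtain ⟨v, hvV, hvκ, hv⟩ := hdir B.start hstart B.dir B.norm_dir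
  have hdet : det₂ B.dir v ≠ 0 := fun h0 => by rw [h0, abs_zero] at hvκ; linarith
  obtain ⟨Z, hZ, hZ0, M, hdiff⟩ := exists_singular_lines hΩ hT hU
  have hcont : ContinuousOn (fun y => quadratic y - U y) (closure Ω) := by
    refine ContinuousOn.sub ?_ (hT.2 ▸ hU.1)
    have : quadratic = fun y : Plane => ‖y‖ ^ 2 := funext quadratic_eq_norm_sq
    rw [this]
    fun_prop
  have hX : ∀ s ∈ Set.Icc 0 (3 * a), ∀ t ∈ Set.Icc 0 a,
      B.start + s • B.dir + t • v ∈ closure Ω := by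
    intro s hs t ht
    refine hv _ (hmem s ⟨hs.1, hs.2.trans haL⟩) ?_ t ⟨ht.1, by linarith [ht.2]⟩
    rw [dist_self_add_left, norm_smul, B.norm_dir, mul_one, Real.norm_of_nonneg hs.1]
    linarith [hs.2]
  obtain ⟨iM, hiM, hiM'⟩ := Finset.exists_max_image (Finset.range (B.N + 1)) t ⟨0, by simp⟩
  obtain ⟨im, him, him'⟩ := Finset.exists_min_image (Finset.range (B.N + 1)) t ⟨0, by simp⟩
  have hosc : t iM - t im ≤ a := hcon iM (by simpa [Nat.lt_succ_iff] using hiM) im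
    (by simpa [Nat.lt_succ_iff] using him)
  have hup : ∀ s s', 0 ≤ s → s ≤ s' → s' ≤ L →
      U (B.start + s' • B.dir) - U (B.start + s • B.dir) ≤ t iM * (s' - s) := by
    intro s s' h0 h1 h2
    exact sub_le_of_piecewise_slope (V := fun s => U (B.start + s • B.dir)) B.pos_lt hslope
      (fun i hi => hiM' i (by simpa [Nat.lt_succ_iff] using hi)) (B.N + 1) le_rfl s s'
      (by rwa [B.pos_zero]) h1 h2
  have hlow : ∀ s s', 0 ≤ s → s ≤ s' → s' ≤ L →
      t im * (s' - s) ≤ U (B.start + s' • B.dir) - U (B.start + s • B.dir) := by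
    intro s s' h0 h1 h2
    have := sub_le_of_piecewise_slope (V := fun s => -U (B.start + s • B.dir))
      (t := fun i => -t i) (M := -t im) B.pos_lt
      (fun i hi s hs s' hs' => by linarith [hslope i hi s hs s' hs'])
      (fun i hi => neg_le_neg (him' i (by simpa [Nat.lt_succ_iff] using hi))) (B.N + 1) le_rfl s s'
      (by rwa [B.pos_zero]) h1 h2
    linarith
  -- The second difference of `u` with step `a` is exactly `2 * a ^ 2`; that of `U` is at most
  -- (largest slope − smallest slope) · `a`, hence at most `a ^ 2`.
  have hsec : ∀ s ∈ Set.Icc 0 a, a ^ 2 ≤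
      |(quadratic (B.start + (s + 2 * a) • B.dir) - U (B.start + (s + 2 * a) • B.dir)) -
        2 * (quadratic (B.start + (s + a) • B.dir) - U (B.start + (s + a) • B.dir)) +
        (quadratic (B.start + s • B.dir) - U (B.start + s • B.dir))| := by
    intro s hs
    refine le_trans ?_ (le_abs_self _)
    have hq : ∀ σ : ℝ, quadratic (B.start + σ • B.dir) =
        ‖B.start‖ ^ 2 + 2 * σ * inner ℝ B.start B.dir + σ ^ 2 := by
      intro σ
      rw [quadratic_eq_norm_sq, norm_add_sq_real, inner_smul_right, norm_smul, B.norm_dir,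
        Real.norm_eq_abs, mul_one, sq_abs]
      ring
    have h1 := hup (s + a) (s + 2 * a) (by linarith [hs.1]) (by linarith) (by linarith [hs.2])
    have h2 := hlow s (s + a) hs.1 (by linarith) (by linarith [hs.2])
    have h3 : (t iM - t im) * a ≤ a * a := mul_le_mul_of_nonneg_right hosc ha0.le
    rw [hq, hq, hq]
    nlinarith
  have hmain := pow_four_le_integral_gradient_sq isClosed_closure.measurableSet hZ hZ0 hcont hdiff
    (integrableOn_gradient_sq hΩ hT hU) B.norm_dir hdet ha0 hX hsec
  rw [restrict_closure_eq hΩ] at hmain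
  have hH0 : 0 < (h ^ α) ^ 2 := pow_pos (Real.rpow_pos_of_pos hh _) 2
  have hfac : 3 * (2 + 4 * ‖v‖) ^ 2 / |det₂ B.dir v| ≤ 3 * (2 + 4 * V) ^ 2 / κ := by gcongr
  have h4 : δ ^ 4 * L ^ 4 ≤ C * (h ^ α) ^ 2 := by
    rw [← mul_pow, ← ha]
    refine hmain.trans ((mul_le_mul hfac hint (integral_nonneg fun x => by positivity)
      (by positivity)).trans (le_of_eq ?_))
    rw [hC]; ring
  -- One factor `L ≤ D + 1` is spent to reach the fifth power, which matches the exponent `2 * α /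
  -- 5` of the length hypothesis.
  have h5 : L ^ 5 ≤ (D + 1) * C / δ ^ 4 * (h ^ α) ^ 2 := by
    have : (D + 1) * C / δ ^ 4 * (h ^ α) ^ 2 = (D + 1) * (C * (h ^ α) ^ 2) / δ ^ 4 := by ring
    rw [this, le_div_iff₀ (by positivity)]
    calc L ^ 5 * δ ^ 4 = L * (δ ^ 4 * L ^ 4) := by ring
      _ ≤ (D + 1) * (C * (h ^ α) ^ 2) :=
        mul_le_mul (by linarith) h4 (by positivity) (by positivity)
  have h6 : (h ^ (2 * α / 5)) ^ 5 = (h ^ α) ^ 2 := by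
    rw [← Real.rpow_natCast, ← Real.rpow_natCast, ← Real.rpow_mul hh.le, ← Real.rpow_mul hh.le]
    congr 1; push_cast; ring
  have h7 := pow_le_pow_left₀ (mul_nonneg (by linarith) (Real.rpow_nonneg hh.le _)) hL 5
  rw [mul_pow, h6] at h7
  -- The summand 1 in `C_L` makes it at most its fifth power and makes the contradiction strict.
  have h8 : 1 + (D + 1) * C / δ ^ 4 ≤ (1 + (D + 1) * C / δ ^ 4) ^ 5 :=
    le_self_pow₀ (by linarith) (by norm_num)
  nlinarith [mul_le_mul_of_nonneg_right h8 hH0.le]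

end Band

/-! ### Elementary inequalities for the summation -/

/-- Both values are compared with `t 0`, whence the factor 2 and no case distinction on the order of
`i` and `j`. -/
theorem sub_le_two_mul_sum_jumps (t : ℕ → ℝ) {N i j : ℕ} (hi : i ≤ N) (hj : j ≤ N) :
    t i - t j ≤ 2 * ∑ k ∈ Finset.range N, |t k - t (k + 1)| := by
  have key : ∀ i ≤ N, |t 0 - t i| ≤ ∑ k ∈ Finset.range N, |t k - t (k + 1)| := by
    intro i hi
    have h1 := dist_le_range_sum_dist t i
    simp only [Real.dist_eq] at h1
    exact h1.trans (Finset.sum_le_sum_of_subset_of_nonneg (by simpa using hi)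
      fun _ _ _ => abs_nonneg _)
  have h1 := (abs_le.1 (key i hi)).1
  have h2 := (abs_le.1 (key j hj)).2
  linarith

/-- Cauchy–Schwarz for a sum of square roots. -/
theorem sum_sqrt_mul_le {N : ℕ} {a x : ℕ → ℝ} (ha : ∀ j < N, 0 ≤ a j) :
    ∑ j ∈ Finset.range N, √(a j) * x j ≤
      √N * √(∑ j ∈ Finset.range N, a j * x j ^ 2) := by
  have h := Real.sum_mul_le_sqrt_mul_sqrt (Finset.range N) (fun _ => (1 : ℝ))
    (fun j => √(a j) * x j)
  have e : ∑ j ∈ Finset.range N, (√(a j) * x j) ^ 2 = ∑ j ∈ Finset.range N, a j * x j ^ 2 := by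
    refine Finset.sum_congr rfl fun j hj => ?_
    rw [mul_pow, Real.sq_sqrt (ha j (Finset.mem_range.1 hj))]
  simpa [e] using h

/-- In the application `p`, `q`, `r` are the distances of the gradients on K̃, the next and the
previous lower triangle from ∇u at the common vertex. The area `a` of K̃ is at most `k` times the
other two, so each square can be weighted by the area of its own triangle. -/
theorem mul_sq_le_of_le {a a₀ a₁ k c p q r x : ℝ} (ha : 0 ≤ a) (hk : 1 ≤ k) (hc : 0 ≤ c)
    (h₀ : a ≤ k * a₀) (h₁ : a ≤ k * a₁) (hx0 : 0 ≤ x) (hp : 0 ≤ p) (hr : 0 ≤ r)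
    (hx : x ≤ (p + q) + c * (r + q)) :
    a * x ^ 2 ≤ 3 * (1 + c) ^ 2 * k * (a * p ^ 2 + a₁ * q ^ 2 + a₀ * r ^ 2) := by
  have h1 : x ≤ (1 + c) * (p + q + r) := by nlinarith
  have h2 : x ^ 2 ≤ (1 + c) ^ 2 * (3 * (p ^ 2 + q ^ 2 + r ^ 2)) := by
    calc x ^ 2 ≤ ((1 + c) * (p + q + r)) ^ 2 := pow_le_pow_left₀ hx0 h1 2
      _ = (1 + c) ^ 2 * (p + q + r) ^ 2 := by ring
      _ ≤ _ := by
        refine mul_le_mul_of_nonneg_left ?_ (by positivity)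
        nlinarith [sq_nonneg (p - q), sq_nonneg (q - r), sq_nonneg (p - r)]
  have h3 : a * (p ^ 2 + q ^ 2 + r ^ 2) ≤ k * (a * p ^ 2 + a₁ * q ^ 2 + a₀ * r ^ 2) := by
    have e1 : a * p ^ 2 ≤ k * a * p ^ 2 :=
      mul_le_mul_of_nonneg_right (le_mul_of_one_le_left ha hk) (sq_nonneg p)
    have e2 := mul_le_mul_of_nonneg_right h₁ (sq_nonneg q)
    have e3 := mul_le_mul_of_nonneg_right h₀ (sq_nonneg r)
    linarith
  calc a * x ^ 2 ≤ a * ((1 + c) ^ 2 * (3 * (p ^ 2 + q ^ 2 + r ^ 2))) :=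
        mul_le_mul_of_nonneg_left h2 ha
    _ = 3 * (1 + c) ^ 2 * (a * (p ^ 2 + q ^ 2 + r ^ 2)) := by ring
    _ ≤ 3 * (1 + c) ^ 2 * (k * (a * p ^ 2 + a₁ * q ^ 2 + a₀ * r ^ 2)) :=
        mul_le_mul_of_nonneg_left h3 (by positivity)
    _ = _ := by ring

/-- Since `h` is unrestricted, `h` alone need not be bounded by a multiple of `h ^ α`; for `h ≥ 1`
the diameter `D` of the domain takes over. -/
theorem min_le_max_one_mul_rpow {α h D : ℝ} (hα : α ∈ Set.Icc (0 : ℝ) 1) (hh : 0 < h) :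
    min h D ≤ max 1 D * h ^ α := by
  have hp := Real.rpow_pos_of_pos hh α
  rcases le_total h 1 with h1 | h1
  · have e : h ≤ h ^ α := by
      simpa using Real.rpow_le_rpow_of_exponent_ge hh h1 hα.2
    calc min h D ≤ 1 * h ^ α := (min_le_left _ _).trans (by rwa [one_mul])
      _ ≤ _ := mul_le_mul_of_nonneg_right (le_max_left _ _) hp.le
  · have e : 1 ≤ h ^ α := Real.one_le_rpow h1 hα.1
    calc min h D ≤ max 1 D := (min_le_right _ _).trans (le_max_right _ _)
      _ ≤ _ := le_mul_of_one_le_right (le_trans zero_le_one (le_max_left _ _)) e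

/-! ### Summing the jumps over the band -/

section Band

variable {T : Geometry.SimplicialComplex ℝ Plane} {Ω : Set Plane} {U : Plane → ℝ}

/-- Gradients on two triangles agree in the direction of a common edge. -/
theorem inner_gradient_sub_eq_zero {g : Finset Plane → Plane} {c : Finset Plane → ℝ}
    (hg : ∀ K ∈ elements T, ∀ x ∈ convexHull ℝ (K : Set Plane), U x = inner ℝ (g K) x + c K)
    {K K' : Finset Plane} (hK : K ∈ elements T) (hK' : K' ∈ elements T) {x y : Plane}
    (hx : x ∈ K) (hy : y ∈ K) (hx' : x ∈ K') (hy' : y ∈ K') :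
    inner ℝ (g K - g K') (x - y) = 0 := by
  have h1 := hg K hK x (subset_convexHull ℝ _ hx)
  have h2 := hg K hK y (subset_convexHull ℝ _ hy)
  have h3 := hg K' hK' x (subset_convexHull ℝ _ hx')
  have h4 := hg K' hK' y (subset_convexHull ℝ _ hy')
  simp only [inner_sub_left, inner_sub_right]
  linarith

/-- The triangle remembers its index through its vertices on Γ, which are exactly two consecutive
base points. Nothing is needed about the apices being distinct. -/
theorem injOn_lower_elements (B : StraightBand T) {k : ℕ → Finset Plane}
    (hk : ∀ i ≤ B.N, (k i : Set Plane) = {B.base i, B.apex i, B.base (i + 1)}) :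
    Set.InjOn k (Set.Iic B.N) := by
  intro i hi j hj hij
  have hi : i ≤ B.N := hi
  have hj : j ≤ B.N := hj
  have hset : ({B.base i, B.apex i, B.base (i + 1)} : Set Plane) =
      {B.base j, B.apex j, B.base (j + 1)} := by rw [← hk i hi, ← hk j hj, hij]
  have key : ∀ l ≤ B.N + 1, B.base l ∈ ({B.base j, B.apex j, B.base (j + 1)} : Set Plane) →
      l = j ∨ l = j + 1 := by
    rintro l hl (h | h | h)
    · exact Or.inl (eq_of_base_eq B hl (by omega) h)
    · exact absurd h.symm (apex_ne_line B hj _)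
    · exact Or.inr (eq_of_base_eq B hl (by omega) h)
  have h1 := key i (by omega) (hset ▸ by simp)
  have h2 := key (i + 1) (by omega) (hset ▸ by simp)
  omega

/-- Here exactly one vertex lies on Γ, and it determines the index. -/
theorem injOn_upper_elements (B : StraightBand T) {k : ℕ → Finset Plane}
    (hk : ∀ j < B.N, (k j : Set Plane) = {B.apex j, B.base (j + 1), B.apex (j + 1)}) :
    Set.InjOn k (Finset.range B.N) := by
  intro i hi j hj hij
  have hi : i < B.N := by simpa using hi
  have hj : j < B.N := by simpa using hj
  have hmem : B.base (i + 1) ∈ (k j : Set Plane) := by rw [← hij, hk i hi]; simp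
  rw [hk j hj] at hmem
  rcases hmem with h | h | h
  · exact absurd h.symm (apex_ne_line B hj.le _)
  · have := eq_of_base_eq B (by omega) (by omega) h
    omega
  · exact absurd h.symm (apex_ne_line B hj _)

/-- The sum over a family of triangles of the squared distances of the gradient of `U` to `∇u`
at a vertex. -/
theorem sum_volume_mul_norm_sub_sq_le (hΩ : IsPolygonalLipschitzDomain Ω)
    (hT : IsTriangulation T Ω) (hU : U ∈ piecewiseLinear T) {g : Finset Plane → Plane}
    {c : Finset Plane → ℝ}
    (hg : ∀ K ∈ elements T, ∀ x ∈ convexHull ℝ (K : Set Plane), U x = inner ℝ (g K) x + c K)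
    {δ : ℝ} (hδ : ∀ K ∈ elements T, Metric.diam (convexHull ℝ (K : Set Plane)) ≤ δ)
    (s : Finset ℕ) {k : ℕ → Finset Plane} (hk : ∀ i ∈ s, k i ∈ elements T)
    (hinj : Set.InjOn k s) {P : ℕ → Plane} (hP : ∀ i ∈ s, P i ∈ k i) :
    ∑ i ∈ s, (volume (convexHull ℝ (k i : Set Plane))).toReal * ‖g (k i) - (2 : ℝ) • P i‖ ^ 2 ≤
      2 * (∫ x in Ω, ‖gradient (fun y => quadratic y - U y) x‖ ^ 2) +
        8 * δ ^ 2 * (volume Ω).toReal := by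
  have hint := integrableOn_gradient_sq hΩ hT hU
  have hc : ∀ S : Set Plane, Bornology.IsBounded S → IntegrableOn (fun _ => 8 * δ ^ 2) S :=
    fun S hS => integrableOn_const hS.measure_lt_top.ne
  have hsum : IntegrableOn (fun x => 2 * ‖gradient (fun y => quadratic y - U y) x‖ ^ 2 +
      8 * δ ^ 2) (closure Ω) := (hint.const_mul 2).add (hc _ hΩ.isBounded.closure)
  calc _ ≤ ∑ i ∈ s, ∫ x in convexHull ℝ (k i : Set Plane),
        (2 * ‖gradient (fun y => quadratic y - U y) x‖ ^ 2 + 8 * δ ^ 2) :=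
        Finset.sum_le_sum fun i hi => volume_mul_norm_sub_sq_le hΩ hT hU (hk i hi)
          (hg _ (hk i hi)) (hP i hi) (hδ _ (hk i hi))
    _ ≤ ∫ x in Ω, (2 * ‖gradient (fun y => quadratic y - U y) x‖ ^ 2 + 8 * δ ^ 2) :=
        sum_setIntegral_elements_le hΩ hT hsum (fun x => by positivity) s hk hinj
    _ = _ := by
        rw [integral_add ((hint.mono_set subset_closure).const_mul 2) (hc _ hΩ.isBounded),
          integral_const_mul, setIntegral_const, smul_eq_mul, mul_comm (volume.real Ω)]
        rfl

/-- If a band is long, so that the slope of `U` along it varies, then the large angles of the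
triangles in the band force a large error. -/
theorem minOver_mul_le (hΩ : IsPolygonalLipschitzDomain Ω) {α : ℝ}
    (hα : α ∈ Set.Icc (0 : ℝ) 1) {C_u C_K C_α δ h : ℝ} (hh : 0 < h)
    (hT : IsTriangulation T Ω)
    (hdiam : ∀ K ∈ elements T, Metric.diam (convexHull ℝ (K : Set Plane)) ≤ h)
    (hU : U ∈ piecewiseLinear T) (B : StraightBand T)
    (herr : ∫ x in Ω, ‖gradient (fun y => quadratic y - U y) x‖ ^ 2 ≤ C_u ^ 2 * (h ^ α) ^ 2)
    (hB : ∀ i ∈ Set.Icc 1 B.N, B.areaKt i ≤ C_K * B.areaK i ∧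
      B.areaKt i ≤ C_K * B.areaK (i - 1) ∧
      Real.sin (Real.pi - B.angleK (i - 1)) ≤ C_α * Real.sin (Real.pi - B.angleKt i))
    (hosc : ∀ t : ℕ → ℝ, (∀ i ≤ B.N, ∀ s ∈ Set.Icc (B.pos i) (B.pos (i + 1)),
        ∀ s' ∈ Set.Icc (B.pos i) (B.pos (i + 1)),
        U (B.start + s' • B.dir) - U (B.start + s • B.dir) = t i * (s' - s)) →
      ∃ i ≤ B.N, ∃ j ≤ B.N, δ * B.length < t i - t j) :
    δ / 2 * B.minOver (fun i => 1 / Real.sin (Real.pi - B.angleKt i)) *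
        B.minOver (fun i => √(B.areaKt i)) * B.length * (B.N : ℝ) ^ (-(1 / 2) : ℝ) ≤
      √(9 * (1 + max C_α 0) ^ 2 * max C_K 1 * (2 * C_u ^ 2 +
        8 * max 1 (Metric.diam (closure Ω)) ^ 2 * (volume Ω).toReal)) * h ^ α := by
  obtain ⟨g, c, hg⟩ := exists_gradients hU
  obtain ⟨k, hk⟩ : ∃ k : ℕ → Finset Plane, ∀ i ≤ B.N, k i ∈ elements T ∧
      (k i : Set Plane) = {B.base i, B.apex i, B.base (i + 1)} := by
    choose! k h1 h2 using B.elem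
    exact ⟨k, fun i hi => ⟨h1 i hi, h2 i hi⟩⟩
  obtain ⟨kt, hkt⟩ : ∃ kt : ℕ → Finset Plane, ∀ j < B.N, kt j ∈ elements T ∧
      (kt j : Set Plane) = {B.apex j, B.base (j + 1), B.apex (j + 1)} := by
    have : ∀ j < B.N, ∃ K ∈ elements T,
        (K : Set Plane) = {B.apex j, B.base (j + 1), B.apex (j + 1)} :=
      fun j hj => B.elem_tilde (j + 1) (by omega) (by omega)
    choose! kt h1 h2 using this
    exact ⟨kt, fun i hi => ⟨h1 i hi, h2 i hi⟩⟩
  have hareaK : ∀ i ≤ B.N,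
      B.areaK i = (volume (convexHull ℝ (k i : Set Plane))).toReal := by
    intro i hi; rw [(hk i hi).2]; rfl
  have hareaKt : ∀ j < B.N,
      B.areaKt (j + 1) = (volume (convexHull ℝ (kt j : Set Plane))).toReal := by
    intro j hj; rw [(hkt j hj).2]; rfl
  -- membership of the vertices
  have hkP : ∀ i ≤ B.N, B.base i ∈ k i := fun i hi => by
    rw [← Finset.mem_coe, (hk i hi).2]; simp
  have hkA : ∀ i ≤ B.N, B.apex i ∈ k i := fun i hi => by
    rw [← Finset.mem_coe, (hk i hi).2]; simp
  have hkP' : ∀ i ≤ B.N, B.base (i + 1) ∈ k i := fun i hi => by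
    rw [← Finset.mem_coe, (hk i hi).2]; simp
  have hktA : ∀ j < B.N, B.apex j ∈ kt j := fun i hi => by
    rw [← Finset.mem_coe, (hkt i hi).2]; simp
  have hktP : ∀ j < B.N, B.base (j + 1) ∈ kt j := fun i hi => by
    rw [← Finset.mem_coe, (hkt i hi).2]; simp
  have hktA' : ∀ j < B.N, B.apex (j + 1) ∈ kt j := fun i hi => by
    rw [← Finset.mem_coe, (hkt i hi).2]; simp
  set cα := max C_α 0 with hcα
  set cK := max C_K 1 with hcK
  have hcα0 : 0 ≤ cα := le_max_right _ _
  have hcK1 : 1 ≤ cK := le_max_right _ _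
  let t : ℕ → ℝ := fun i => inner ℝ (g (k i)) B.dir
  obtain ⟨i₁, hi₁, i₂, hi₂, hlt⟩ := hosc t (by
    intro i hi s hs s' hs'
    have h1 := line_mem_triangle B hs
    have h2 := line_mem_triangle B hs'
    rw [← (hk i hi).2] at h1 h2
    rw [hg _ (hk i hi).1 _ h1, hg _ (hk i hi).1 _ h2]
    simp only [t, inner_add_right, inner_smul_right]
    ring)
  set m₁ := B.minOver (fun i => 1 / Real.sin (Real.pi - B.angleKt i)) with hm₁
  set m₂ := B.minOver (fun i => √(B.areaKt i)) with hm₂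
  have hangleKt : ∀ j < B.N, Real.sin (Real.pi - B.angleKt (j + 1)) =
      Real.sin (EuclideanGeometry.angle (B.apex j) (B.base (j + 1)) (B.apex (j + 1))) := by
    intro j hj
    rw [Real.sin_pi_sub]
    exact congrArg Real.sin (B.maxAngle_elem_tilde (j + 1) (by omega) (by omega))
  have hangleK : ∀ j ≤ B.N, Real.sin (Real.pi - B.angleK j) =
      Real.sin (EuclideanGeometry.angle (B.base j) (B.apex j) (B.base (j + 1))) := by
    intro j hj
    rw [Real.sin_pi_sub]
    exact congrArg Real.sin (B.maxAngle_elem j hj)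
  have hsin0 : ∀ i ∈ Finset.Icc 1 B.N, 0 ≤ Real.sin (Real.pi - B.angleKt i) := by
    intro i hi
    obtain ⟨h1, h2⟩ := Finset.mem_Icc.1 hi
    obtain ⟨j, rfl⟩ : ∃ j, i = j + 1 := ⟨i - 1, by omega⟩
    rw [hangleKt j (by omega)]
    exact Real.sin_nonneg_of_nonneg_of_le_pi (EuclideanGeometry.angle_nonneg _ _ _)
      (EuclideanGeometry.angle_le_pi _ _ _)
  have hm₁0 : 0 ≤ m₁ := (Finset.le_inf'_iff _ _).2 fun i hi =>
    div_nonneg zero_le_one (hsin0 i hi)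
  have hm₂0 : 0 ≤ m₂ := (Finset.le_inf'_iff _ _).2 fun i _ => Real.sqrt_nonneg _
  -- This is the bound for the jump after the sine at K̃ is factored out; `cα` comes from comparing
  -- the sine at the lower triangle with it.
  let x : ℕ → ℝ := fun j => ‖g (kt j) - g (k (j + 1))‖ + cα * ‖g (k j) - g (k (j + 1))‖
  have hx0 : ∀ j, 0 ≤ x j := fun j => by positivity
  have hjump : ∀ j < B.N, m₁ * m₂ * |t j - t (j + 1)| ≤ √(B.areaKt (j + 1)) * x j := by
    intro j hj
    have hmem : j + 1 ∈ Finset.Icc 1 B.N := Finset.mem_Icc.2 ⟨by omega, by omega⟩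
    have h1 : m₁ ≤ 1 / Real.sin (Real.pi - B.angleKt (j + 1)) := Finset.inf'_le _ hmem
    have h2 : m₂ ≤ √(B.areaKt (j + 1)) := Finset.inf'_le _ hmem
    have hs0 := hsin0 (j + 1) hmem
    have h3 := abs_inner_sub_le (Q := B.base j) (P := B.base (j + 1)) (A := B.apex j)
      (A' := B.apex (j + 1)) (g₀ := g (k j)) (g₁ := g (k (j + 1))) (gt := g (kt j))
      B.norm_dir (ℓ := B.pos (j + 1) - B.pos j) (sub_pos.2 (B.pos_lt j hj.le))
      (by simp only [StraightBand.base]; module) (apex_ne_line B hj.le _)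
      (apex_ne_line B hj _) (apex_ne_line B hj.le _).symm (B.maxAngle_elem j hj.le)
      (inner_gradient_sub_eq_zero hg (hkt j hj).1 (hk j hj.le).1 (hktA j hj) (hktP j hj)
        (hkA j hj.le) (hkP' j hj.le))
      (inner_gradient_sub_eq_zero hg (hkt j hj).1 (hk (j + 1) hj).1 (hktA' j hj) (hktP j hj)
        (hkA (j + 1) hj) (hkP (j + 1) hj))
    rw [← hangleKt j hj, ← hangleK j hj.le] at h3
    have h4 : Real.sin (Real.pi - B.angleK j) ≤ Real.sin (Real.pi - B.angleKt (j + 1)) * cα := by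
      refine ((hB (j + 1) ⟨by omega, hj⟩).2.2).trans ?_
      rw [mul_comm]
      exact mul_le_mul_of_nonneg_left (le_max_left _ _) hs0
    have h5 : |t j - t (j + 1)| ≤ x j * Real.sin (Real.pi - B.angleKt (j + 1)) := by
      have e : t j - t (j + 1) = inner ℝ (g (k j) - g (k (j + 1))) B.dir := by
        rw [inner_sub_left]
      rw [e]
      refine h3.trans ?_
      have := mul_le_mul_of_nonneg_right h4 (norm_nonneg (g (k j) - g (k (j + 1))))
      simp only [x]
      linarith
    have h6 : m₁ * |t j - t (j + 1)| ≤ x j := by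
      refine (mul_le_mul_of_nonneg_right h1 (abs_nonneg _)).trans ?_
      rw [one_div_mul_eq_div]
      -- A nonnegative sine suffices: were it zero, the quotient would be 0 by convention.
      exact div_le_of_le_mul₀ hs0 (hx0 j) h5
    calc m₁ * m₂ * |t j - t (j + 1)| = m₂ * (m₁ * |t j - t (j + 1)|) := by ring
      _ ≤ √(B.areaKt (j + 1)) * x j :=
        mul_le_mul h2 h6 (by positivity) (Real.sqrt_nonneg _)
  set D := Metric.diam (closure Ω) with hD
  have hdiam' : ∀ K ∈ elements T, Metric.diam (convexHull ℝ (K : Set Plane)) ≤ min h D :=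
    fun K hK => le_min (hdiam K hK)
      (Metric.diam_mono (convexHull_subset_closure hT hK) hΩ.isBounded.closure)
  have hmin0 : 0 ≤ min h D := le_min hh.le Metric.diam_nonneg
  set W := (volume Ω).toReal with hW
  have hW0 : 0 ≤ W := ENNReal.toReal_nonneg
  set I := ∫ x in Ω, ‖gradient (fun y => quadratic y - U y) x‖ ^ 2 with hI
  have hbound : 2 * I + 8 * min h D ^ 2 * W ≤
      (2 * C_u ^ 2 + 8 * max 1 D ^ 2 * W) * (h ^ α) ^ 2 := by
    have e1 : min h D ^ 2 ≤ (max 1 D * h ^ α) ^ 2 :=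
      pow_le_pow_left₀ hmin0 (min_le_max_one_mul_rpow hα hh) 2
    have e2 := mul_le_mul_of_nonneg_right e1 hW0
    nlinarith
  have hinj := injOn_lower_elements B fun i hi => (hk i hi).2
  -- All three families are compared with ∇u at the same point `B.base (j + 1)`, the vertex shared
  -- by K̃ and both neighbouring lower triangles, so the comparison cancels in gradient differences.
  have S₁ := sum_volume_mul_norm_sub_sq_le hΩ hT hU hg hdiam' (Finset.range B.N) (k := kt)
    (fun j hj => (hkt j (Finset.mem_range.1 hj)).1)
    (injOn_upper_elements B fun j hj => (hkt j hj).2) (P := fun j => B.base (j + 1))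
    (fun j hj => hktP j (Finset.mem_range.1 hj))
  have S₂ := sum_volume_mul_norm_sub_sq_le hΩ hT hU hg hdiam' (Finset.range B.N)
    (k := fun j => k (j + 1)) (fun j hj => (hk (j + 1) (Finset.mem_range.1 hj)).1)
    (fun i hi j hj hij => by
      have := hinj (Finset.mem_range.1 hi : i + 1 ≤ B.N) (Finset.mem_range.1 hj : j + 1 ≤ B.N) hij
      omega) (P := fun j => B.base (j + 1))
    (fun j hj => hkP (j + 1) (Finset.mem_range.1 hj))
  have S₃ := sum_volume_mul_norm_sub_sq_le hΩ hT hU hg hdiam' (Finset.range B.N)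
    (k := k) (fun j hj => (hk j (Finset.mem_range.1 hj).le).1)
    (fun i hi j hj hij => hinj (Finset.mem_range.1 hi).le (Finset.mem_range.1 hj).le hij)
    (P := fun j => B.base (j + 1))
    (fun j hj => hkP' j (Finset.mem_range.1 hj).le)
  -- The constant 9 is the 3 of `mul_sq_le_of_le` times the three families.
  have hsq : ∑ j ∈ Finset.range B.N, B.areaKt (j + 1) * x j ^ 2 ≤
      9 * (1 + cα) ^ 2 * cK * (2 * C_u ^ 2 + 8 * max 1 D ^ 2 * W) * (h ^ α) ^ 2 := by
    have hterm : ∀ j ∈ Finset.range B.N, B.areaKt (j + 1) * x j ^ 2 ≤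
        3 * (1 + cα) ^ 2 * cK *
          ((volume (convexHull ℝ (kt j : Set Plane))).toReal *
              ‖g (kt j) - (2 : ℝ) • B.base (j + 1)‖ ^ 2 +
            (volume (convexHull ℝ (k (j + 1) : Set Plane))).toReal *
              ‖g (k (j + 1)) - (2 : ℝ) • B.base (j + 1)‖ ^ 2 +
            (volume (convexHull ℝ (k j : Set Plane))).toReal *
              ‖g (k j) - (2 : ℝ) • B.base (j + 1)‖ ^ 2) := by
      intro j hj
      have hj : j < B.N := Finset.mem_range.1 hj
      obtain ⟨hA, hA', -⟩ := hB (j + 1) ⟨by omega, hj⟩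
      have hA' : B.areaKt (j + 1) ≤ C_K * B.areaK j := hA'
      rw [hareaKt j hj, hareaK (j + 1) hj] at hA
      rw [hareaKt j hj, hareaK j hj.le] at hA'
      rw [hareaKt j hj]
      refine mul_sq_le_of_le ENNReal.toReal_nonneg hcK1 hcα0
        (hA'.trans (mul_le_mul_of_nonneg_right (le_max_left _ _) ENNReal.toReal_nonneg))
        (hA.trans (mul_le_mul_of_nonneg_right (le_max_left _ _) ENNReal.toReal_nonneg))
        (hx0 j) (norm_nonneg _) (norm_nonneg _) ?_
      have htri : ∀ y z p : Plane, ‖y - z‖ ≤ ‖y - p‖ + ‖z - p‖ := fun y z p => by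
        simpa using norm_sub_le (y - p) (z - p)
      exact add_le_add (htri _ _ _) (mul_le_mul_of_nonneg_left (htri _ _ _) hcα0)
    refine (Finset.sum_le_sum hterm).trans ?_
    rw [← Finset.mul_sum, Finset.sum_add_distrib, Finset.sum_add_distrib]
    have e : 0 ≤ 3 * (1 + cα) ^ 2 * cK := by positivity
    refine (mul_le_mul_of_nonneg_left (add_le_add (add_le_add S₁ S₂) S₃) e).trans ?_
    refine (mul_le_mul_of_nonneg_left
      (add_le_add (add_le_add hbound hbound) hbound) e).trans (le_of_eq (by ring))
  set E := 9 * (1 + cα) ^ 2 * cK * (2 * C_u ^ 2 + 8 * max 1 D ^ 2 * W) with hE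
  have hp0 : 0 ≤ h ^ α := Real.rpow_nonneg hh.le α
  have hN0 : 0 < (B.N : ℝ) := by exact_mod_cast B.one_le_N
  have hfinal : m₁ * m₂ * (δ * B.length) ≤ 2 * (√B.N * (√E * h ^ α)) := by
    calc m₁ * m₂ * (δ * B.length)
        ≤ m₁ * m₂ * (2 * ∑ j ∈ Finset.range B.N, |t j - t (j + 1)|) :=
          mul_le_mul_of_nonneg_left (hlt.le.trans (sub_le_two_mul_sum_jumps t hi₁ hi₂))
            (by positivity)
      _ = 2 * ∑ j ∈ Finset.range B.N, m₁ * m₂ * |t j - t (j + 1)| := by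
          rw [← Finset.mul_sum]; ring
      _ ≤ 2 * ∑ j ∈ Finset.range B.N, √(B.areaKt (j + 1)) * x j :=
          mul_le_mul_of_nonneg_left
            (Finset.sum_le_sum fun j hj => hjump j (Finset.mem_range.1 hj)) zero_le_two
      _ ≤ 2 * (√B.N * √(∑ j ∈ Finset.range B.N, B.areaKt (j + 1) * x j ^ 2)) :=
          mul_le_mul_of_nonneg_left (sum_sqrt_mul_le (a := fun j => B.areaKt (j + 1))
            fun j hj => ENNReal.toReal_nonneg) zero_le_two
      _ ≤ 2 * (√B.N * (√E * h ^ α)) := by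
          refine mul_le_mul_of_nonneg_left (mul_le_mul_of_nonneg_left ?_ (Real.sqrt_nonneg _))
            zero_le_two
          rw [← Real.sqrt_sq hp0, ← Real.sqrt_mul' _ (sq_nonneg _)]
          exact Real.sqrt_le_sqrt hsq
  have hNpow : (B.N : ℝ) ^ (-(1 / 2) : ℝ) = (√B.N)⁻¹ := by
    rw [Real.rpow_neg hN0.le, Real.sqrt_eq_rpow]
  rw [hNpow, ← div_eq_mul_inv, div_le_iff₀ (Real.sqrt_pos.2 hN0)]
  linarith

end Band

end FEMBand

end

theorem theorem2p1 (Ω : Set FEMBand.Plane) (hΩ : FEMBand.IsPolygonalLipschitzDomain Ω)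
    (α : ℝ) (hα : α ∈ Set.Icc (0 : ℝ) 1) (C_u : ℝ) :
    ∃ C_L > (0 : ℝ), ∃ C₁ > (0 : ℝ), ∀ C_K C_α : ℝ, ∃ C₂ > (0 : ℝ),
      ∀ (h : ℝ) (T : Geometry.SimplicialComplex ℝ FEMBand.Plane) (U : FEMBand.Plane → ℝ)
        (B : FEMBand.StraightBand T),
        0 < h →
        FEMBand.IsTriangulation T Ω →
        (∀ K ∈ FEMBand.elements T, Metric.diam (convexHull ℝ (K : Set FEMBand.Plane)) ≤ h) →
        U ∈ FEMBand.piecewiseLinear T →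
        FEMBand.h1Seminorm Ω (fun x => FEMBand.quadratic x - U x) ≤ C_u * h ^ α →
        (∀ i ∈ Set.Icc 1 B.N,
          B.areaKt i ≤ C_K * B.areaK i ∧
          B.areaKt i ≤ C_K * B.areaK (i - 1) ∧
          Real.sin (Real.pi - B.angleK (i - 1)) ≤
            C_α * Real.sin (Real.pi - B.angleKt i)) →
        C_L * h ^ (2 * α / 5) ≤ B.length →
        ∃ A₁ A₂ : ℝ,
          A₁ - A₂ ≤ FEMBand.h1Seminorm B.region (fun x => FEMBand.quadratic x - U x) ∧
          C₁ * B.minOver (fun i => 1 / Real.sin (Real.pi - B.angleKt i)) *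
              B.minOver (fun i => Real.sqrt (B.areaKt i)) *
              B.length * (B.N : ℝ) ^ (-(1 / 2) : ℝ) ≤ A₁ ∧
          |A₂| ≤ C₂ * h ^ α := by
  obtain ⟨C_L, hC_L, δ, hδ, hosc⟩ := FEMBand.exists_slope_oscillation hΩ α C_u
  refine ⟨C_L, hC_L, δ / 2, half_pos hδ, fun C_K C_α => ?_⟩
  -- The added 1 only ensures that `C₂` is positive.
  refine ⟨√(9 * (1 + max C_α 0) ^ 2 * max C_K 1 * (2 * C_u ^ 2 +
    8 * max 1 (Metric.diam (closure Ω)) ^ 2 * (volume Ω).toReal)) + 1, by positivity, ?_⟩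
  intro h T U B hh hT hdiam hU herr hB hL
  have hp : 0 < h ^ α := Real.rpow_pos_of_pos hh α
  have herr' := (Real.sqrt_le_iff.1 herr).2
  rw [mul_pow] at herr'
  have hmain := FEMBand.minOver_mul_le hΩ hα hh hT hdiam hU B herr' hB
    fun t ht => hosc h T U B t hh hT hU herr' hL ht
  -- `A₁` is the required lower bound itself and `A₂` is `C₂ * h ^ α`. By `hmain` the difference is
  -- nonpositive, so nonnegativity of the seminorm finishes the proof.
  refine ⟨_, _, ?_, le_rfl, (abs_of_nonneg (mul_nonneg (by positivity) hp.le)).le⟩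
  have hnonneg : 0 ≤ FEMBand.h1Seminorm B.region (fun x => FEMBand.quadratic x - U x) :=
    Real.sqrt_nonneg _
  linarith
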